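/- Let $n\ge 1$ and $\Lambda=\mathbb Z/n$ (discrete). All homomorphisms and cochains are continuous, and cohomology is continuous-cochain cohomology with trivial action on $\Lambda$. For a profinite group $\mathfrak G$ put $\mathfrak G^{(1)}=\mathfrak G$, let $\mathfrak G^{(i+1)}$ be the closed subgroup generated by $[\mathfrak G,\mathfrak G^{(i)}]$ and the $n$th powers of elements of $\mathfrak G^{(i)}$, and let $\mathfrak g_i=\mathfrak G^{(i)}/\mathfrak G^{(i+1)}$, written additively. For $\sigma,\tau\in\mathfrak g_1$ with lifts $\tilde\sigma,\tilde\tau\in\mathfrak G/\mathfrak G^{(3)}$ put $[\sigma,\tau]=\tilde\sigma^{-1}\tilde\tau^{-1}\tilde\sigma\tilde\tau\in\mathfrak g_2$ and $\sigma^\pi=\tilde\sigma^{\,n}\in\mathfrak g_2$; these do not depend on the lifts. Assume that $\mathfrak g_1\cong(\mathbb Z/n)^I$ as topological groups, for some set $I$. Let $\mathfrak K=H^1(\mathfrak g_1,\Lambda)=\operatorname{Hom}(\mathfrak g_1,\Lambda)$, and let $\mathfrak g_1\hat\otimes\mathfrak g_1=\varprojlim\,\mathfrak g_1/N_1\otimes_\Lambda\mathfrak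 g_1/N_2$ over the open subgroups $N_1,N_2$ of $\mathfrak g_1$. Its elements $f$ are regarded as bilinear forms on $\mathfrak K$ through $(\sigma\otimes\tau)(x,y)=x(\sigma)y(\tau)$, and elements $g\in\mathfrak g_1$ as functions on $\mathfrak K$ through $g(x)=x(g)$. Put $$\mathfrak S=\Big\{(f,g)\in(\mathfrak g_1\hat\otimes\mathfrak g_1)\times\mathfrak g_1:\ f(x,x)=\tbinom n2 g(x)\ \text{ for all }x\in\mathfrak K\Big\}.$$ Then there is a unique bilinear pairing $(\cdot,\cdot)_{\mathfrak S}:\mathfrak S\times H^2(\mathfrak g_1,\Lambda)\to\Lambda$ with $((f,g),x\cup y)_{\mathfrak S}=f(x,y)$ and $((f,g),\beta z)_{\mathfrak S}=g(z)$ for all $x,y,z\in\mathfrak K$, where $\beta$ is the Bockstein map of $0\to\mathbb Z/n\xrightarrow{\,n\,}\mathbb Z/n^2\to\mathbb Z/n\to0$. For a subset $R\subseteq H^2(\mathfrak g_1,\Lambda)$ let $\operatorname{res}_R:\mathfrak S\to\operatorname{Fun}(R,\Lambda)=\Lambda^R$, $s\mapsto(r\mapsto(s,r)_{\mathfrak S})$,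 and let $\mathfrak S_R$ be its image, with the subspace topology of the product topology. **Theorem.** Let $R$ be any generating set of $\ker\big(\inf:H^2(\mathfrak g_1,\Lambda)\to H^2(\mathfrak G,\Lambda)\big)$. There is exactly one isomorphism of topological groups $\Omega_R:\mathfrak g_2\to\mathfrak S_R$ such that, for all $\sigma,\tau\in\mathfrak g_1$, $$\Omega_R([\sigma,\tau])=\operatorname{res}_R(\sigma\otimes\tau-\tau\otimes\sigma,\,0),\qquad \Omega_R(\sigma^\pi)=\operatorname{res}_R\big(\tbinom n2\,\sigma\otimes\sigma,\ \sigma\big).$$ **Functoriality.** Let $\phi:\mathfrak G\to\mathfrak H$ be a homomorphism of profinite groups that both satisfy the assumption, with induced maps $\phi_i:\mathfrak g_i(\mathfrak G)\to\mathfrak g_i(\mathfrak H)$ and $\phi_1^*:H^2(\mathfrak g_1(\mathfrak H),\Lambda)\to H^2(\mathfrak g_1(\mathfrak G),\Lambda)$. Let $R(\mathfrak G)$, $R(\mathfrak H)$ be generating sets of the kernels of the respective inflation maps with $\phi_1^*(R(\mathfrak H))\subseteq R(\mathfrak G)$. Then $c\mapsto c\circ\phi_1^*|_{R(\mathfrak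 H)}$ defines a continuous homomorphism $\phi_1^{**}:\mathfrak S_{R(\mathfrak G)}\to\mathfrak S_{R(\mathfrak H)}$, and $\phi_1^{**}\circ\Omega_{R(\mathfrak G)}=\Omega_{R(\mathfrak H)}\circ\phi_2$. In particular $\phi_1^{**}(\Omega_{R(\mathfrak G)}([\sigma,\tau]))=\Omega_{R(\mathfrak H)}([\phi_1\sigma,\phi_1\tau])$ and $\phi_1^{**}(\Omega_{R(\mathfrak G)}(\sigma^\pi))=\Omega_{R(\mathfrak H)}((\phi_1\sigma)^\pi)$ for all $\sigma,\tau\in\mathfrak g_1(\mathfrak G)$. -/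

import Mathlib

open scoped TensorProduct

noncomputable section

namespace ProfiniteH2

section Series

variable (n : ℕ) (G : Type*) [Group G] [TopologicalSpace G] [IsTopologicalGroup G]

/-- The closed subgroup `[G, U] · U ^ n`. -/
def seriesStep (U : Subgroup G) : Subgroup G :=
  (⁅(⊤ : Subgroup G), U⁆ ⊔ Subgroup.closure {x | ∃ u ∈ U, x = u ^ n}).topologicalClosure

/-- The mod-`n` central descending series, indexed so that `centralSeries n G 1 = G` and
`centralSeries n G (i + 1) = [G, centralSeries n G i] · (centralSeries n G i) ^ n` for `i ≥ 1`
(the value at `0` is not used). -/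
def centralSeries : ℕ → Subgroup G
  | 0 => ⊤
  | 1 => ⊤
  | i + 2 => seriesStep n G (centralSeries (i + 1))

instance seriesStep_normal (U : Subgroup G) [U.Normal] : (seriesStep n G U).Normal := by
  have h : (Subgroup.closure {x | ∃ u ∈ U, x = u ^ n}).Normal := by
    refine Subgroup.Normal.mk fun x hx g => ?_
    induction hx using Subgroup.closure_induction with
    | mem x hx =>
      obtain ⟨u, hu, rfl⟩ := hx
      refine Subgroup.subset_closure ⟨g * u * g⁻¹, Subgroup.Normal.conj_mem ‹_› u hu g, ?_⟩
      rw [conj_pow]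
    | one => simp
    | mul x y _ _ hx hy =>
      have : g * (x * y) * g⁻¹ = (g * x * g⁻¹) * (g * y * g⁻¹) := by group
      rw [this]; exact mul_mem hx hy
    | inv x _ hx =>
      have : g * x⁻¹ * g⁻¹ = (g * x * g⁻¹)⁻¹ := by group
      rw [this]; exact inv_mem hx
  exact Subgroup.is_normal_topologicalClosure _

instance centralSeries_normal : ∀ i, (centralSeries n G i).Normal
  | 0 => inferInstanceAs (⊤ : Subgroup G).Normal
  | 1 => inferInstanceAs (⊤ : Subgroup G).Normal
  | i + 2 =>
    haveI := centralSeries_normal (i + 1)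
    inferInstanceAs (seriesStep n G (centralSeries n G (i + 1))).Normal

variable {n G}

theorem commutator_mem_succ {i : ℕ} (hi : 1 ≤ i) (g : G) {u : G} (hu : u ∈ centralSeries n G i) :
    g * u * g⁻¹ * u⁻¹ ∈ centralSeries n G (i + 1) := by
  obtain ⟨i, rfl⟩ := Nat.exists_eq_add_of_le' hi
  exact Subgroup.le_topologicalClosure _
    (Subgroup.mem_sup_left (Subgroup.commutator_mem_commutator (Subgroup.mem_top g) hu))

theorem pow_mem_succ {i : ℕ} (hi : 1 ≤ i) {u : G} (hu : u ∈ centralSeries n G i) :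
    u ^ n ∈ centralSeries n G (i + 1) := by
  obtain ⟨i, rfl⟩ := Nat.exists_eq_add_of_le' hi
  exact Subgroup.le_topologicalClosure _
    (Subgroup.mem_sup_right (Subgroup.subset_closure ⟨u, hu, rfl⟩))

theorem comm_mem_two (a b : G) : a⁻¹ * b⁻¹ * a * b ∈ centralSeries n G 2 := by
  have h := commutator_mem_succ (n := n) le_rfl a⁻¹ (u := b⁻¹) (Subgroup.mem_top _)
  simpa using h

theorem pow_mem_two (a : G) : a ^ n ∈ centralSeries n G 2 :=
  pow_mem_succ le_rfl (Subgroup.mem_top _)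

/-- Continuous homomorphisms respect the mod-`n` central descending series. -/
theorem centralSeries_le_comap {H : Type*} [Group H] [TopologicalSpace H] [IsTopologicalGroup H]
    (f : G →ₜ* H) :
    ∀ i, centralSeries n G i ≤ (centralSeries n H i).comap (f : G →* H)
  | 0 => fun _ _ => Subgroup.mem_top _
  | 1 => fun _ _ => Subgroup.mem_top _
  | i + 2 => by
    have ih := centralSeries_le_comap f (i + 1)
    refine Subgroup.topologicalClosure_minimal _ (sup_le ?_ ?_) ?_
    · rw [Subgroup.commutator_le]
      intro a _ b hb
      have h := commutator_mem_succ (Nat.le_add_left 1 i) (f a) (ih hb)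
      simpa [commutatorElement_def] using h
    · rw [Subgroup.closure_le]
      rintro _ ⟨u, hu, rfl⟩
      have h := pow_mem_succ (Nat.le_add_left 1 i) (ih hu)
      simp only [SetLike.mem_coe, Subgroup.mem_comap, map_pow]
      exact h
    · exact (Subgroup.isClosed_topologicalClosure _).preimage f.continuous_toFun

variable (n G)

/-- The first graded piece, `G / G⁽²⁾`, written multiplicatively. -/
abbrev G1 : Type _ := G ⧸ centralSeries n G 2

/-- The second graded piece, `G⁽²⁾ / G⁽³⁾`, written multiplicatively. -/
abbrev G2 : Type _ :=
  ↥(centralSeries n G 2) ⧸ (centralSeries n G 3).subgroupOf (centralSeries n G 2)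

instance : CommGroup (G1 n G) where
  mul_comm x y := by
    induction x using QuotientGroup.induction_on with | H a => ?_
    induction y using QuotientGroup.induction_on with | H b => ?_
    rw [← QuotientGroup.mk_mul, ← QuotientGroup.mk_mul, QuotientGroup.eq]
    simpa [mul_assoc] using comm_mem_two (n := n) b a

instance : CommGroup (G2 n G) where
  mul_comm x y := by
    induction x using QuotientGroup.induction_on with | H a => ?_
    induction y using QuotientGroup.induction_on with | H b => ?_
    rw [← QuotientGroup.mk_mul, ← QuotientGroup.mk_mul, QuotientGroup.eq,
      Subgroup.mem_subgroupOf]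
    have h := commutator_mem_succ (n := n) (i := 2) (by norm_num) ((b : G)⁻¹)
      (inv_mem a.2)
    simpa [mul_assoc] using h

theorem G1_pow (x : G1 n G) : x ^ n = 1 := by
  induction x using QuotientGroup.induction_on with | H a => ?_
  rw [← QuotientGroup.mk_pow, QuotientGroup.eq_one_iff]
  exact pow_mem_two a

/-- The first graded piece, written additively. -/
abbrev A1 : Type _ := Additive (G1 n G)

/-- The second graded piece, written additively. -/
abbrev A2 : Type _ := Additive (G2 n G)

instance : Module (ZMod n) (A1 n G) :=
  AddCommGroup.zmodModule fun x => congrArg Additive.ofMul (G1_pow n G x.toMul)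

variable {n G}

/-- The class of an element of `G` in the first graded piece. -/
def mk1 (a : G) : A1 n G := Additive.ofMul (QuotientGroup.mk a)

/-- The class of an element of `G⁽²⁾` in the second graded piece. -/
def mk2 (a : centralSeries n G 2) : A2 n G := Additive.ofMul (QuotientGroup.mk a)

theorem three_of_eq {a b : G} (h : (QuotientGroup.mk a : G1 n G) = QuotientGroup.mk b) :
    ∀ g : G, (QuotientGroup.mk (a⁻¹ * b * g) : G ⧸ centralSeries n G 3)
      = QuotientGroup.mk (g * (a⁻¹ * b)) := by
  intro g
  rw [QuotientGroup.eq] at h ⊢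
  have := commutator_mem_succ (n := n) (i := 2) (by norm_num) (g⁻¹) (inv_mem h)
  simpa [mul_assoc] using this

/-- The commutator `[σ, τ] = s⁻¹ t⁻¹ s t`, where `s`, `t` are arbitrary lifts of `σ`, `τ`. -/
def bracket (σ τ : A1 n G) : A2 n G :=
  Quotient.liftOn₂' σ.toMul τ.toMul
    (fun a b => mk2 ⟨a⁻¹ * b⁻¹ * a * b, comm_mem_two a b⟩) (by
      intro a b a' b' ha hb
      have ha' := three_of_eq (n := n) (Quotient.sound' ha)
      have hb' := three_of_eq (n := n) (Quotient.sound' hb)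
      refine congrArg Additive.ofMul (QuotientGroup.eq.2 ?_)
      rw [Subgroup.mem_subgroupOf]
      change (a⁻¹ * b⁻¹ * a * b)⁻¹ * (a'⁻¹ * b'⁻¹ * a' * b') ∈ centralSeries n G 3
      rw [← QuotientGroup.eq]
      obtain ⟨c, rfl⟩ : ∃ c, a' = a * c := ⟨a⁻¹ * a', by group⟩
      obtain ⟨d, rfl⟩ : ∃ d, b' = b * d := ⟨b⁻¹ * b', by group⟩
      simp only [inv_mul_cancel_left, QuotientGroup.mk_mul] at ha' hb'
      have hc : ∀ g : G ⧸ centralSeries n G 3, Commute (c : G ⧸ centralSeries n G 3) g :=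
        fun g => QuotientGroup.induction_on g ha'
      have hd : ∀ g : G ⧸ centralSeries n G 3, Commute (d : G ⧸ centralSeries n G 3) g :=
        fun g => QuotientGroup.induction_on g hb'
      simp only [QuotientGroup.mk_mul, QuotientGroup.mk_inv]
      generalize (a : G ⧸ centralSeries n G 3) = a at *
      generalize (b : G ⧸ centralSeries n G 3) = b at *
      generalize (c : G ⧸ centralSeries n G 3) = c at *
      generalize (d : G ⧸ centralSeries n G 3) = d at *
      calc a⁻¹ * b⁻¹ * a * b
          = a⁻¹ * b⁻¹ * a * b * (c⁻¹ * c) * (d⁻¹ * d) := by simp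
        _ = (a * c)⁻¹ * (b * d)⁻¹ * (a * c) * (b * d) := by
          have h1 := (hc (a⁻¹ * b⁻¹ * a * b)).inv_left.eq
          have h2 := (hd (a⁻¹ * b⁻¹ * a * b)).inv_left.eq
          rw [mul_inv_rev, mul_inv_rev]
          have e1 : c⁻¹ * a⁻¹ * (d⁻¹ * b⁻¹) * (a * c) * (b * d)
              = c⁻¹ * (a⁻¹ * (d⁻¹ * (b⁻¹ * (a * (c * b))))) * d := by simp only [mul_assoc]
          rw [e1, (hc b).eq]
          have e2 : c⁻¹ * (a⁻¹ * (d⁻¹ * (b⁻¹ * (a * (b * c))))) * d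
              = c⁻¹ * (a⁻¹ * d⁻¹) * (b⁻¹ * a * b) * (c * d) := by simp only [mul_assoc]
          rw [e2, ← (hd a⁻¹).inv_left.eq]
          have e3 : c⁻¹ * (d⁻¹ * a⁻¹) * (b⁻¹ * a * b) * (c * d)
              = c⁻¹ * (d⁻¹ * (a⁻¹ * b⁻¹ * a * b)) * (c * d) := by simp only [mul_assoc]
          rw [e3, h2, ← mul_assoc c⁻¹, h1, (hc d).eq]
          have e4 : a⁻¹ * b⁻¹ * a * b * c⁻¹ * d⁻¹ * (d * c)
            = a⁻¹ * b⁻¹ * a * b * (c⁻¹ * (d⁻¹ * d) * c) := by simp only [mul_assoc]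
          rw [e4]
          simp)

/-- The power `σ ^ π = s ^ n`, where `s` is an arbitrary lift of `σ`. -/
def powPi (σ : A1 n G) : A2 n G :=
  Quotient.liftOn' σ.toMul (fun a => mk2 ⟨a ^ n, pow_mem_two a⟩) (by
    intro a a' ha
    have ha' := three_of_eq (n := n) (Quotient.sound' ha)
    have hm : a⁻¹ * a' ∈ centralSeries n G 2 := QuotientGroup.leftRel_apply.1 ha
    refine congrArg Additive.ofMul (QuotientGroup.eq.2 ?_)
    rw [Subgroup.mem_subgroupOf]
    change (a ^ n)⁻¹ * a' ^ n ∈ centralSeries n G 3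
    rw [← QuotientGroup.eq]
    obtain ⟨c, rfl⟩ : ∃ c, a' = a * c := ⟨a⁻¹ * a', by group⟩
    simp only [inv_mul_cancel_left] at ha' hm
    have hc : Commute (a : G ⧸ centralSeries n G 3) c := by
      have := ha' a
      simp only [QuotientGroup.mk_mul] at this
      exact this.symm
    have h1 : (c : G ⧸ centralSeries n G 3) ^ n = 1 := by
      rw [← QuotientGroup.mk_pow, QuotientGroup.eq_one_iff]
      exact pow_mem_succ (by norm_num) hm
    rw [QuotientGroup.mk_pow, QuotientGroup.mk_pow, QuotientGroup.mk_mul, hc.mul_pow, h1, mul_one])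

variable {H : Type*} [Group H] [TopologicalSpace H] [IsTopologicalGroup H]

variable (n) in
/-- The homomorphism between first graded pieces induced by `f` (multiplicative notation). -/
def map1 (f : G →ₜ* H) : G1 n G →ₜ* G1 n H where
  toMonoidHom := QuotientGroup.map _ _ (f : G →* H) (centralSeries_le_comap f 2)
  continuous_toFun := by
    refine continuous_quot_lift _ ?_
    exact QuotientGroup.continuous_mk.comp f.continuous_toFun

variable (n) in
/-- The homomorphism between first graded pieces induced by `f` (additive notation). -/
def map1Add (f : G →ₜ* H) : A1 n G →+ A1 n H :=
  MonoidHom.toAdditive (map1 n f : G1 n G →* G1 n H)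

variable (n) in
/-- The homomorphism between the second terms of the series induced by `f`. -/
def restrict2 (f : G →ₜ* H) : centralSeries n G 2 →* centralSeries n H 2 :=
  ((f : G →* H).comp (centralSeries n G 2).subtype).codRestrict _
    fun x => centralSeries_le_comap f 2 x.2

variable (n) in
/-- The homomorphism between second graded pieces induced by `f` (additive notation). -/
def map2 (f : G →ₜ* H) : A2 n G →+ A2 n H :=
  MonoidHom.toAdditive <| QuotientGroup.map _ _ (restrict2 n f) fun _ hx =>
    centralSeries_le_comap f 3 (Subgroup.mem_subgroupOf.1 hx)

variable (n G) in
/-- The projection of `G` onto its first graded piece. -/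
def proj1 : G →ₜ* G1 n G where
  toMonoidHom := QuotientGroup.mk' _
  continuous_toFun := QuotientGroup.continuous_mk

end Series

section Cohomology

variable (n : ℕ) (M : Type*) [Group M] [TopologicalSpace M] [IsTopologicalGroup M]

/-- `H¹(M, ℤ/n)` for the trivial action: continuous homomorphisms `M → ℤ/n`. -/
abbrev H1 : Type _ := Additive M →ₜ+ ZMod n

/-- The coboundary of continuous 1-cochains. -/
def d1 : C(M, ZMod n) →+ C(M × M, ZMod n) where
  toFun u := ⟨fun p => u p.2 - u (p.1 * p.2) + u p.1, by fun_prop⟩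
  map_zero' := by ext; simp
  map_add' u v := by ext; simp only [ContinuousMap.coe_mk, ContinuousMap.add_apply]; ring

/-- Continuous inhomogeneous 2-cocycles with values in the trivial module `ℤ/n`. -/
def Z2 : AddSubgroup C(M × M, ZMod n) where
  carrier := {ξ | ∀ a b c, ξ (b, c) - ξ (a * b, c) + ξ (a, b * c) - ξ (a, b) = 0}
  zero_mem' := by simp
  add_mem' {ξ η} hξ hη a b c := by
    have h1 := hξ a b c
    have h2 := hη a b c
    simp only [ContinuousMap.add_apply]
    linear_combination h1 + h2
  neg_mem' {ξ} hξ a b c := by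
    have h1 := hξ a b c
    simp only [ContinuousMap.neg_apply]
    linear_combination -h1

/-- `H²(M, ℤ/n)` for the trivial action: continuous 2-cocycles modulo coboundaries. -/
abbrev H2 : Type _ := ↥(Z2 n M) ⧸ (d1 n M).range.addSubgroupOf (Z2 n M)

variable {M}

/-- The pullback of 2-cocycles along a continuous homomorphism. -/
def Z2map {M' : Type*} [Group M'] [TopologicalSpace M'] [IsTopologicalGroup M']
    (f : M →ₜ* M') : Z2 n M' →+ Z2 n M where
  toFun ξ := ⟨ξ.1.comp ⟨fun p => (f p.1, f p.2), by fun_prop⟩, by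
    intro a b c
    have h := ξ.2
    simpa using h (f a) (f b) (f c)⟩
  map_zero' := rfl
  map_add' _ _ := rfl

/-- The pullback `f^* : H²(M') → H²(M)` along a continuous homomorphism `f : M → M'`. -/
def H2map {M' : Type*} [Group M'] [TopologicalSpace M'] [IsTopologicalGroup M']
    (f : M →ₜ* M') : H2 n M' →+ H2 n M :=
  QuotientAddGroup.map _ _ (Z2map n f) (by
    intro ξ hξ
    have hξ' : (ξ : C(M' × M', ZMod n)) ∈ (d1 n M').range := hξ
    obtain ⟨u, hu⟩ := hξ'
    change (Z2map n f ξ : C(M × M, ZMod n)) ∈ (d1 n M).range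
    refine ⟨u.comp ⟨f, f.continuous_toFun⟩, ?_⟩
    ext p
    have h := DFunLike.congr_fun hu (f p.1, f p.2)
    simp only [d1, AddMonoidHom.coe_mk, ZeroHom.coe_mk, ContinuousMap.coe_mk] at h
    rw [← map_mul] at h
    exact h)

variable {n}

/-- The cup product `H¹ × H¹ → H²`: the class of `(a, b) ↦ x(a) y(b)`. -/
def cup (x y : H1 n M) : H2 n M :=
  QuotientAddGroup.mk (⟨⟨fun p => x (Additive.ofMul p.1) * y (Additive.ofMul p.2),
    (x.continuous_toFun.comp (continuous_ofMul.comp continuous_fst)).mul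
      (y.continuous_toFun.comp (continuous_ofMul.comp continuous_snd))⟩, fun a b c => by
    simp only [ContinuousMap.coe_mk, ofMul_mul, map_add]; ring⟩ : Z2 n M)

/-- The carry of an addition modulo `n`. -/
def carry (a b : ZMod n) : ZMod n := ((a.val + b.val) / n : ℕ)

/-- With the section `a ↦ a.val` of `ℤ/n² → ℤ/n`, the image of `carry a b` under the injection
`n : ℤ/n → ℤ/n²` is the failure of the section to be additive. -/
theorem carry_spec [NeZero n] (a b : ZMod n) :
    ((n * (carry a b).val : ℕ) : ZMod (n ^ 2))
      = (b.val : ZMod (n ^ 2)) - ((a + b).val : ZMod (n ^ 2)) + (a.val : ZMod (n ^ 2)) := by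
  have h : n * ((a.val + b.val) / n) + (a + b).val = a.val + b.val := by
    rw [ZMod.val_add]; exact Nat.div_add_mod _ _
  have h2 : ((n * (carry a b).val : ℕ) : ZMod (n ^ 2))
      = ((n * ((a.val + b.val) / n) : ℕ) : ZMod (n ^ 2)) := by
    rw [ZMod.natCast_eq_natCast_iff, carry, ZMod.val_natCast, pow_two]
    exact Nat.ModEq.mul_left' n (Nat.mod_modEq _ _)
  have h3 := congrArg (Nat.cast : ℕ → ZMod (n ^ 2)) h
  push_cast at h2 h3 ⊢
  rw [h2]
  linear_combination h3

theorem carry_cocycle [NeZero n] (a b c : ZMod n) :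
    carry b c - carry (a + b) c + carry a (b + c) - carry a b = 0 := by
  have e : ∀ x y : ZMod n, n * ((x.val + y.val) / n) + (x + y).val = x.val + y.val := by
    intro x y; rw [ZMod.val_add]; exact Nat.div_add_mod _ _
  have h1 := e b c
  have h2 := e (a + b) c
  have h3 := e a (b + c)
  have h4 := e a b
  rw [add_assoc] at h2
  have hn : 0 < n := Nat.pos_of_ne_zero (NeZero.ne n)
  have h : (b.val + c.val) / n + (a.val + (b + c).val) / n
      = ((a + b).val + c.val) / n + (a.val + b.val) / n := by
    refine Nat.eq_of_mul_eq_mul_left hn ?_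
    rw [mul_add, mul_add]
    omega
  have h' := congrArg (Nat.cast : ℕ → ZMod n) h
  push_cast at h'
  unfold carry
  linear_combination h'

/-- The Bockstein homomorphism, i.e. the connecting map `H¹(M, ℤ/n) → H²(M, ℤ/n)` of
`0 → ℤ/n → ℤ/n² → ℤ/n → 0`: lift `z` to the cochain `a ↦ (z a).val` with values in `ℤ/n²`, take
its coboundary and divide by `n`; by `carry_spec` this is `(a, b) ↦ carry (z a) (z b)`. -/
def bockstein [NeZero n] (z : H1 n M) : H2 n M :=
  QuotientAddGroup.mk (⟨⟨fun p => carry (z (Additive.ofMul p.1)) (z (Additive.ofMul p.2)),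
    (continuous_of_discreteTopology (f := fun q : ZMod n × ZMod n => carry q.1 q.2)).comp
      ((z.continuous_toFun.comp (continuous_ofMul.comp continuous_fst)).prodMk
        (z.continuous_toFun.comp (continuous_ofMul.comp continuous_snd)))⟩, fun a b c => by
    simp only [ContinuousMap.coe_mk, ofMul_mul, map_add]
    exact carry_cocycle _ _ _⟩ : Z2 n M)

end Cohomology

section Tensor

variable (n : ℕ) (A : Type*) [AddCommGroup A] [Module (ZMod n) A] [TopologicalSpace A]

/-- The open subgroups of `A` (which are `ℤ/n`-submodules, as `A` is a `ℤ/n`-module). -/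
abbrev OpenSub : Type _ := {N : Submodule (ZMod n) A // IsOpen (N : Set A)}

/-- The completed tensor product of `A` with itself: the inverse limit of
`A/N₁ ⊗ A/N₂` over all pairs of open subgroups. -/
def CTensor :
    AddSubgroup ((P : OpenSub n A × OpenSub n A) → (A ⧸ P.1.1) ⊗[ZMod n] (A ⧸ P.2.1)) where
  carrier := {t | ∀ (P Q : OpenSub n A × OpenSub n A) (h₁ : P.1.1 ≤ Q.1.1) (h₂ : P.2.1 ≤ Q.2.1),
    TensorProduct.map (Submodule.factor h₁) (Submodule.factor h₂) (t P) = t Q}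
  zero_mem' P Q h₁ h₂ := by simp
  add_mem' {s t} hs ht P Q h₁ h₂ := by
    simp only [Pi.add_apply, map_add, hs P Q h₁ h₂, ht P Q h₁ h₂]
  neg_mem' {s} hs P Q h₁ h₂ := by
    simp only [Pi.neg_apply, map_neg, hs P Q h₁ h₂]

variable {n A}

/-- The element `σ ⊗ τ` of the completed tensor product. -/
def ctmul (σ τ : A) : CTensor n A :=
  ⟨fun P => P.1.1.mkQ σ ⊗ₜ[ZMod n] P.2.1.mkQ τ, fun P Q h₁ h₂ => by simp⟩

/-- The kernel of a continuous homomorphism to `ℤ/n`, an open subgroup. -/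
def openKer (x : A →ₜ+ ZMod n) : OpenSub n A :=
  ⟨LinearMap.ker ((x : A →+ ZMod n).toZModLinearMap n),
    (isOpen_discrete ({0} : Set (ZMod n))).preimage x.continuous_toFun⟩

/-- The homomorphism `A / ker x → ℤ/n` induced by `x`. -/
def quotKer (x : A →ₜ+ ZMod n) : (A ⧸ (openKer x).1) →ₗ[ZMod n] ZMod n :=
  (openKer x).1.liftQ ((x : A →+ ZMod n).toZModLinearMap n) le_rfl

/-- The value `f(x, y)` of an element `f` of the completed tensor product, seen as a bilinear form:
the component of `f` in `A / ker x ⊗ A / ker y` is evaluated by `σ ⊗ τ ↦ x(σ) y(τ)`. -/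
def ceval (x y : A →ₜ+ ZMod n) : CTensor n A →+ ZMod n where
  toFun f := TensorProduct.lift
    ((LinearMap.mul (ZMod n) (ZMod n)).compl₁₂ (quotKer x) (quotKer y)) (f.1 (openKer x, openKer y))
  map_zero' := by simp
  map_add' f g := by simp

theorem ceval_ctmul (x y : A →ₜ+ ZMod n) (σ τ : A) : ceval x y (ctmul σ τ) = x σ * y τ := rfl

end Tensor

section Main

variable (n : ℕ) (G : Type*) [Group G] [TopologicalSpace G] [IsTopologicalGroup G]

/-- The group of all pairs `(f, g)` with `f(x, x) = (n choose 2) g(x)` for all `x ∈ H¹(𝔤₁)`, where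
`f` lies in the completed tensor square of the first graded piece `𝔤₁` and `g ∈ 𝔤₁` is regarded as
the function `x ↦ x(g)`. -/
def Sfr : AddSubgroup (CTensor n (A1 n G) × A1 n G) where
  carrier := {s | ∀ x : H1 n (G1 n G), ceval x x s.1 = (n.choose 2 : ZMod n) * x s.2}
  zero_mem' := by simp
  add_mem' {s t} hs ht x := by
    simp only [Prod.fst_add, Prod.snd_add, map_add, hs x, ht x, mul_add]
  neg_mem' {s} hs x := by
    simp only [Prod.fst_neg, Prod.snd_neg, map_neg, hs x, mul_neg]

variable {n G}

/-- The element `(σ ⊗ τ - τ ⊗ σ, 0)`. -/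
def sBracket (σ τ : A1 n G) : Sfr n G :=
  ⟨(ctmul σ τ - ctmul τ σ, 0), fun x => by
    simp only [map_sub, ceval_ctmul, map_zero]; ring⟩

theorem choose_two_mul_sq (a : ℤ) :
    ((n.choose 2 : ZMod n)) * ((a : ZMod n) * (a : ZMod n)) = (n.choose 2 : ZMod n) * a := by
  obtain ⟨k, hk⟩ := Int.even_mul_pred_self a
  have h : (n.choose 2 : ℤ) * 2 = n * ((n : ℤ) - 1) := by
    cases n with
    | zero => simp
    | succ m =>
      have := Nat.triangle_succ m
      rw [Nat.choose_two_right]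
      have h2 := Nat.div_mul_cancel (Nat.even_mul_pred_self (m + 1)).two_dvd
      have h3 := congrArg (Nat.cast : ℕ → ℤ) h2
      push_cast at h3 ⊢
      simpa using h3
  have h4 : (n.choose 2 : ℤ) * (a * a) = (n.choose 2 : ℤ) * a + n * (((n : ℤ) - 1) * k) := by
    linear_combination (n.choose 2 : ℤ) * hk + k * h
  have h5 := congrArg (Int.cast : ℤ → ZMod n) h4
  push_cast at h5
  simpa using h5

/-- The element `((n choose 2) σ ⊗ σ, σ)`. -/
def sPow (σ : A1 n G) : Sfr n G :=
  ⟨(n.choose 2 • ctmul σ σ, σ), fun x => by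
    obtain ⟨a, ha⟩ := ZMod.intCast_surjective (x σ)
    simp only [map_nsmul, ceval_ctmul, nsmul_eq_mul]
    rw [← ha]
    exact choose_two_mul_sq a⟩

/-- `P` is a bilinear pairing of `Sfr n G` with `H²(𝔤₁)` such that `P (f, g) (x ∪ y) = f(x, y)` and
`P (f, g) (β z) = g(z)`. -/
def IsPairing [NeZero n] (P : Sfr n G →+ H2 n (G1 n G) →+ ZMod n) : Prop :=
  (∀ (s : Sfr n G) (x y : H1 n (G1 n G)), P s (cup x y) = ceval x y s.1.1) ∧
  (∀ (s : Sfr n G) (z : H1 n (G1 n G)), P s (bockstein z) = z s.1.2)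

variable (n G)

open Classical in
/-- The bilinear pairing of `Sfr n G` with `H²(𝔤₁)` that is characterised by `IsPairing` (it takes
the value `0` if there is no such pairing). -/
def pairing [NeZero n] : Sfr n G →+ H2 n (G1 n G) →+ ZMod n :=
  if h : ∃ P : Sfr n G →+ H2 n (G1 n G) →+ ZMod n, IsPairing P then h.choose else 0

/-- The inflation map `H²(𝔤₁) → H²(G)`. -/
def inf2 : H2 n (G1 n G) →+ H2 n G := H2map n (proj1 n G)

variable {n G}

/-- The homomorphism `res_R : Sfr → Fun(R, ℤ/n)`, `s ↦ (r ↦ (s, r))`. -/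
def res [NeZero n] (R : Set (H2 n (G1 n G))) : Sfr n G →+ (R → ZMod n) where
  toFun s r := pairing n G s r
  map_zero' := by ext; simp
  map_add' s t := by ext; simp

/-- The image of `res_R`, a subgroup of `Fun(R, ℤ/n)` (with the topology of `(ℤ/n)^R`). -/
def SR [NeZero n] (R : Set (H2 n (G1 n G))) : AddSubgroup (R → ZMod n) := (res R).range

/-- The defining properties of the isomorphism `Ω_R`: it sends `[σ, τ]` to
`res_R (σ ⊗ τ - τ ⊗ σ, 0)` and `σ ^ π` to `res_R ((n choose 2) σ ⊗ σ, σ)`. -/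
def IsOmega [NeZero n] {R : Set (H2 n (G1 n G))} (Ω : A2 n G ≃ₜ+ SR R) : Prop :=
  (∀ σ τ : A1 n G, (Ω (bracket σ τ) : R → ZMod n) = res R (sBracket σ τ)) ∧
  (∀ σ : A1 n G, (Ω (powPi σ) : R → ZMod n) = res R (sPow σ))

end Main

end ProfiniteH2

end

open ProfiniteH2

/-! Let u be a cochain on `G` that bounds the inflation of a 2-cocycle ξ on `G1`. On G⁽²⁾, up to
sign and the constant u(1), it is a continuous homomorphism that kills G⁽³⁾, hence a character of
`A2`. This map, inverse to the transgression, identifies the kernel of inflation with the group of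
continuous characters of `A2` (`range_boundedClass`, `class_eq_zero_of_transgress`,
`transgress_eq_zero_of_class`, `exists_transgress_eq`). The character takes the value ξ(σ, τ) - ξ(τ,
σ) at [σ, τ] and ∑ ξ(σ ^ k, σ), over k < n, at σ ^ π.

The same two forms detect H² of `G1`. If both vanish on a class, the corresponding extension is
abelian of exponent n, so it splits, even continuously (`H2_eq_zero_of_forms`). In coordinates, H²
is therefore generated by cup products and Bocksteins of coordinate characters, and a homomorphism
from H² to ℤ/n is the same as a pair of forms (B, γ) with B(x, x) = (n choose 2) γ(x). This gives
the pairing, and shows that every homomorphism from H² to ℤ/n is the pairing with an element of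
`Sfr` (`exists_H2_hom`, `exists_pairing_eq`).

Now Ω sends a ∈ `A2` to the function r ↦ (character of r)(a). Its values lie in `SR R`, since a
functional on the kernel of inflation extends to H², ℤ/n being injective among groups killed by n.
It is onto because a functional on a group of characters of a compact group is an evaluation
(`exists_eval_eq`), and injective because characters separate points of `A2`. Uniqueness and
naturality hold because commutators and n-th powers topologically generate `A2` (`A2_hom_ext`). -/

noncomputable section

namespace ProfiniteH2

/-! ### Duality with values in ℤ/n for groups killed by n. -/

section Duality

variable (n : ℕ) [NeZero n]

/-- The embedding of `ℤ/n` into `ℚ/ℤ` as the `n`-torsion subgroup. -/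
def zmodToRatCircle : ZMod n →+ AddCircle (1 : ℚ) :=
  ZMod.lift n ⟨AddMonoidHom.mk' (fun j : ℤ => ((j / n : ℚ) : AddCircle (1 : ℚ)))
    (by simp [add_div]), by simp⟩

theorem zmodToRatCircle_natCast (j : ℕ) :
    zmodToRatCircle n j = ((j / n : ℚ) : AddCircle (1 : ℚ)) := by
  have := ZMod.lift_coe n ⟨AddMonoidHom.mk' (fun j : ℤ => ((j / n : ℚ) : AddCircle (1 : ℚ)))
    (by simp [add_div]), by simp⟩ (j : ℤ)
  simpa [zmodToRatCircle] using this

theorem zmodToRatCircle_injective : Function.Injective (zmodToRatCircle n) := by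
  intro x y hxy
  have : (0 : ℚ) < n := Nat.cast_pos.mpr (NeZero.pos _)
  rw [← ZMod.natCast_zmod_val x, ← ZMod.natCast_zmod_val y, zmodToRatCircle_natCast,
    zmodToRatCircle_natCast, AddCircle.coe_eq_coe_iff_of_mem_Ico (a := 0),
    div_left_inj' this.ne', Nat.cast_inj] at hxy
  · exact ZMod.val_injective n hxy
  all_goals exact ⟨by positivity, by
    simpa only [zero_add, div_lt_one this, Nat.cast_lt] using ZMod.val_lt _⟩

variable {n}

/-- A character of a group killed by n takes values in the n-torsion of ℚ/ℤ, which is the copy of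
ℤ/n. Through this, the injectivity of ℚ/ℤ passes to ℤ/n. -/
theorem exists_comp_zmodToRatCircle {A : Type*} [AddCommGroup A] (hA : ∀ a : A, n • a = 0)
    (c : A →+ AddCircle (1 : ℚ)) : ∃ c' : A →+ ZMod n, ∀ a, zmodToRatCircle n (c' a) = c a := by
  have h : ∀ a, c a ∈ (zmodToRatCircle n).range := by
    intro a
    have h0 : n • c a = 0 := by rw [← map_nsmul, hA, map_zero]
    obtain ⟨m, -, hm⟩ := (AddCircle.nsmul_eq_zero_iff (NeZero.pos n)).1 h0
    exact ⟨(m : ZMod n), by rw [zmodToRatCircle_natCast, ← hm, mul_one]⟩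
  refine ⟨(AddMonoidHom.ofInjective (zmodToRatCircle_injective n)).symm.toAddMonoidHom.comp
    (c.codRestrict _ h), fun a => ?_⟩
  exact congrArg Subtype.val
    ((AddMonoidHom.ofInjective (zmodToRatCircle_injective n)).apply_symm_apply ⟨c a, h a⟩)

/-- `ℤ/n` is an injective cogenerator of the abelian groups killed by `n`: separation. -/
theorem exists_hom_zmod_ne_zero {A : Type*} [AddCommGroup A] (hA : ∀ a : A, n • a = 0) {a : A}
    (ha : a ≠ 0) : ∃ c : A →+ ZMod n, c a ≠ 0 := by
  obtain ⟨c, hc⟩ := CharacterModule.exists_character_apply_ne_zero_of_ne_zero ha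
  obtain ⟨c', hc'⟩ := exists_comp_zmodToRatCircle hA (c : A →+ AddCircle (1 : ℚ))
  refine ⟨c', fun h => hc ?_⟩
  have := hc' a
  rw [h, map_zero] at this
  exact this.symm

/-- `ℤ/n` is an injective cogenerator of the abelian groups killed by `n`: extension. -/
theorem exists_hom_zmod_extension {T A : Type*} [AddCommGroup T] [AddCommGroup A]
    (hA : ∀ a : A, n • a = 0) (q : T →+ A) (η : T →+ ZMod n) (h : ∀ t, q t = 0 → η t = 0) :
    ∃ θ : A →+ ZMod n, ∀ t, θ (q t) = η t := by
  -- η descends to T / ker q, which embeds in A, and ℚ/ℤ is divisible.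
  obtain ⟨c, hc⟩ := (Module.Baer.of_divisible (AddCircle (1 : ℚ))).extension_property_addMonoidHom
    (QuotientAddGroup.kerLift q) (QuotientAddGroup.kerLift_injective q)
    ((zmodToRatCircle n).comp (QuotientAddGroup.lift q.ker η h))
  obtain ⟨c', hc'⟩ := exists_comp_zmodToRatCircle hA c
  refine ⟨c', fun t => zmodToRatCircle_injective n ?_⟩
  rw [hc']
  exact DFunLike.congr_fun hc (QuotientAddGroup.mk t)

/-- A homomorphism out of a group of characters of a compact group is the evaluation at a point. -/
theorem exists_eval_eq {A T : Type*} [AddCommGroup A] [TopologicalSpace A] [CompactSpace A]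
    [AddCommGroup T] (h : T →+ A →+ ZMod n) (hc : ∀ t, Continuous (h t)) (θ : T →+ ZMod n)
    (hθ : ∀ t, h t = 0 → θ t = 0) : ∃ a, ∀ t, h t a = θ t := by
  classical
  suffices H : (⋂ t, {a | h t a = θ t}).Nonempty by
    obtain ⟨a, ha⟩ := H
    exact ⟨a, fun t => Set.mem_iInter.1 ha t⟩
  -- By compactness it suffices to meet finitely many conditions t ∈ F at once. If this fails, the
  -- tuple (θ t) lies outside the image of A in (ℤ/n)^F, and a character c separates it from that
  -- image.
  refine CompactSpace.iInter_nonempty (fun t => isClosed_eq (hc t) continuous_const) fun F => ?_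
  let m : A →+ (F → ZMod n) := AddMonoidHom.mk' (fun a t => h t a) (fun a b => by ext; simp)
  by_contra hne
  have hθF : (QuotientAddGroup.mk (fun t : F => θ t) : (F → ZMod n) ⧸ m.range) ≠ 0 := by
    intro h0
    obtain ⟨a, ha⟩ := (QuotientAddGroup.eq_zero_iff _).1 h0
    exact hne ⟨a, Set.mem_iInter₂.2 fun t ht => congrFun ha ⟨t, ht⟩⟩
  obtain ⟨c, hc0⟩ := exists_hom_zmod_ne_zero (n := n) (fun a => by
    induction a using QuotientAddGroup.induction_on with | H y => ?_
    rw [← QuotientAddGroup.mk_nsmul]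
    have : n • y = 0 := by ext; simp
    rw [this, QuotientAddGroup.mk_zero]) hθF
  let ψ : F → ZMod n := fun t => c (QuotientAddGroup.mk (Pi.single t 1))
  have hψ : ∀ y : F → ZMod n, c (QuotientAddGroup.mk y) = ∑ t, (ψ t).val • y t := by
    intro y
    have hy : y = ∑ t, (y t).val • Pi.single t (1 : ZMod n) := by
      ext s
      rw [Finset.sum_apply]
      simp only [Pi.smul_apply, Pi.single_apply]
      simp
    conv_lhs => rw [hy]
    change (c.comp (QuotientAddGroup.mk' _)) _ = _
    rw [map_sum]
    refine Finset.sum_congr rfl fun t _ => ?_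
    rw [map_nsmul]
    change (y t).val • ψ t = _
    simp [mul_comm]
  -- c is the linear form with coefficients ψ. As c kills the image of A, the combination ∑ ψ(t) t
  -- is killed by h, hence by θ, so c kills (θ t) after all.
  have h0 : h (∑ t : F, (ψ t).val • (t : T)) = 0 := by
    ext a
    have := hψ (m a)
    have hm : (QuotientAddGroup.mk (m a) : (F → ZMod n) ⧸ m.range) = 0 :=
      (QuotientAddGroup.eq_zero_iff (m a)).2 ⟨a, rfl⟩
    rw [hm, map_zero] at this
    rw [map_sum, AddMonoidHom.finsetSum_apply]
    simp only [map_nsmul, AddMonoidHom.nsmul_apply, AddMonoidHom.zero_apply]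
    exact this.symm
  have h1 := hθ _ h0
  rw [map_sum] at h1
  simp only [map_nsmul] at h1
  exact hc0 ((hψ _).trans h1)

end Duality

/-! ### The commutator and power forms on H². -/

section Invariants

theorem Z2_apply_one_left {n : ℕ} {M : Type*} [Group M] [TopologicalSpace M]
    (ξ : Z2 n M) (a : M) : ξ.1 (1, a) = ξ.1 (1, 1) := by
  have := ξ.2 1 1 a
  simp only [one_mul, mul_one] at this
  linear_combination this

theorem Z2_apply_one_right {n : ℕ} {M : Type*} [Group M] [TopologicalSpace M]
    (ξ : Z2 n M) (a : M) : ξ.1 (a, 1) = ξ.1 (1, 1) := by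
  have := ξ.2 a 1 1
  simp only [mul_one] at this
  linear_combination -this

variable {n : ℕ} {M : Type*} [CommGroup M] [TopologicalSpace M] [IsTopologicalGroup M]

theorem H2_nsmul_eq_zero (h : H2 n M) : n • h = 0 := by
  induction h using QuotientAddGroup.induction_on with | H ξ => ?_
  rw [← QuotientAddGroup.mk_nsmul]
  have : n • ξ = 0 := by
    ext p
    simp
  rw [this, QuotientAddGroup.mk_zero]

theorem H2_mk_eq_zero_iff (ξ : Z2 n M) : (QuotientAddGroup.mk ξ : H2 n M) = 0 ↔
    ∃ u : C(M, ZMod n), ∀ a b, ξ.1 (a, b) = u b - u (a * b) + u a := by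
  rw [QuotientAddGroup.eq_zero_iff]
  constructor
  · rintro ⟨u, hu⟩
    exact ⟨u, fun a b => (DFunLike.congr_fun hu (a, b)).symm⟩
  · rintro ⟨u, hu⟩
    exact ⟨u, ContinuousMap.ext fun p => (hu p.1 p.2).symm⟩

/-- The commutator form `ξ ↦ ξ(σ, τ) - ξ(τ, σ)` on classes of 2-cocycles. -/
def commForm (σ τ : M) : H2 n M →+ ZMod n :=
  QuotientAddGroup.lift _
    (AddMonoidHom.mk' (fun ξ : Z2 n M => ξ.1 (σ, τ) - ξ.1 (τ, σ)) fun ξ η => by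
      simp only [AddSubgroup.coe_add, ContinuousMap.add_apply]; ring) (by
    intro ξ hξ
    obtain ⟨u, hu⟩ := (H2_mk_eq_zero_iff ξ).1 ((QuotientAddGroup.eq_zero_iff _).2 hξ)
    rw [AddMonoidHom.mem_ker, AddMonoidHom.mk'_apply, hu, hu, mul_comm τ σ]
    ring)

theorem commForm_mk (σ τ : M) (ξ : Z2 n M) :
    commForm σ τ (QuotientAddGroup.mk ξ : H2 n M) = ξ.1 (σ, τ) - ξ.1 (τ, σ) := rfl

/-- The power form `ξ ↦ ∑ ξ(σ ^ k, σ)` on classes of 2-cocycles of a group of exponent `n`. -/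
def powForm (hM : ∀ a : M, a ^ n = 1) (σ : M) : H2 n M →+ ZMod n :=
  QuotientAddGroup.lift _
    (AddMonoidHom.mk' (fun ξ : Z2 n M => ∑ k ∈ Finset.range n, ξ.1 (σ ^ k, σ)) fun ξ η => by
      simp only [AddSubgroup.coe_add, ContinuousMap.add_apply, Finset.sum_add_distrib]) (by
    intro ξ hξ
    obtain ⟨u, hu⟩ := (H2_mk_eq_zero_iff ξ).1 ((QuotientAddGroup.eq_zero_iff _).2 hξ)
    rw [AddMonoidHom.mem_ker, AddMonoidHom.mk'_apply]
    -- The sum telescopes for a coboundary. At m = n the first term vanishes in ℤ/n, and the other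
    -- two cancel because σ ^ n = 1.
    have h : ∀ m, ∑ k ∈ Finset.range m, ξ.1 (σ ^ k, σ) = m * u σ - u (σ ^ m) + u 1 := by
      intro m
      induction m with
      | zero => simp
      | succ m ih =>
        rw [Finset.sum_range_succ, ih, hu, ← pow_succ]
        push_cast
        ring
    rw [h, hM]
    simp)

theorem powForm_mk (hM : ∀ a : M, a ^ n = 1) (σ : M) (ξ : Z2 n M) :
    powForm hM σ (QuotientAddGroup.mk ξ : H2 n M) = ∑ k ∈ Finset.range n, ξ.1 (σ ^ k, σ) := rfl

theorem commForm_cup (σ τ : M) (x y : H1 n M) : commForm σ τ (cup x y) =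
    x (Additive.ofMul σ) * y (Additive.ofMul τ) - x (Additive.ofMul τ) * y (Additive.ofMul σ) :=
  rfl

theorem powForm_cup (hM : ∀ a : M, a ^ n = 1) (σ : M) (x y : H1 n M) :
    powForm hM σ (cup x y) =
      (n.choose 2 : ZMod n) * (x (Additive.ofMul σ) * y (Additive.ofMul σ)) := by
  change ∑ k ∈ Finset.range n, x (Additive.ofMul (σ ^ k)) * y (Additive.ofMul σ) = _
  simp only [ofMul_pow, map_nsmul, nsmul_eq_mul, mul_assoc]
  rw [← Finset.sum_mul, ← Nat.cast_sum, Finset.sum_range_id, Nat.choose_two_right]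

theorem commForm_mul_left (σ σ' τ : M) (h : H2 n M) :
    commForm (σ * σ') τ h = commForm σ τ h + commForm σ' τ h := by
  induction h using QuotientAddGroup.induction_on with | H ξ => ?_
  simp only [commForm_mk]
  have h1 := ξ.2 σ σ' τ
  have h2 := ξ.2 τ σ σ'
  have h3 := ξ.2 σ τ σ'
  rw [mul_comm τ σ] at h2
  rw [mul_comm τ σ'] at h3
  linear_combination h3 - h1 - h2

theorem commForm_swap (σ τ : M) (h : H2 n M) : commForm σ τ h = - commForm τ σ h := by
  induction h using QuotientAddGroup.induction_on with | H ξ => ?_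
  simp only [commForm_mk, neg_sub]

theorem commForm_self (σ : M) (h : H2 n M) : commForm σ σ h = 0 := by
  induction h using QuotientAddGroup.induction_on with | H ξ => ?_
  simp only [commForm_mk, sub_self]

theorem commForm_mul_right (σ τ τ' : M) (h : H2 n M) :
    commForm σ (τ * τ') h = commForm σ τ h + commForm σ τ' h := by
  rw [commForm_swap, commForm_mul_left, neg_add, ← commForm_swap, ← commForm_swap]

theorem continuous_commForm (h : H2 n M) : Continuous fun p : M × M => commForm p.1 p.2 h := by
  induction h using QuotientAddGroup.induction_on with | H ξ => ?_
  simp only [commForm_mk]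
  exact ξ.1.continuous.sub (ξ.1.continuous.comp continuous_swap)

theorem continuous_powForm (hM : ∀ a : M, a ^ n = 1) (h : H2 n M) :
    Continuous fun σ : M => powForm hM σ h := by
  induction h using QuotientAddGroup.induction_on with | H ξ => ?_
  simp only [powForm_mk]
  exact continuous_finsetSum _ fun k _ => ξ.1.continuous.comp (by fun_prop)

/-- For normalized ξ, the power form is the n-th power of a lift of σ to the extension defined by ξ.
When the commutator form vanishes that extension is abelian, so taking n-th powers is a
homomorphism. -/
theorem powForm_mul (hM : ∀ a : M, a ^ n = 1) (h : H2 n M) (hc : ∀ σ τ, commForm σ τ h = 0)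
    (σ τ : M) : powForm hM (σ * τ) h = powForm hM σ h + powForm hM τ h := by
  induction h using QuotientAddGroup.induction_on with | H ξ => ?_
  simp only [commForm_mk, sub_eq_zero] at hc
  simp only [powForm_mk]
  -- In the extension this compares (ab)(cd) with (ac)(bd), and uses the symmetry of ξ.
  have h4 : ∀ a b c d : M, ξ.1 (a * b, c * d) + ξ.1 (a, b) + ξ.1 (c, d)
      = ξ.1 (a, c) + ξ.1 (b, d) + ξ.1 (a * c, b * d) := by
    intro a b c d
    have h1 := ξ.2 a b (c * d)
    have h2 := ξ.2 a c (b * d)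
    have h3 := ξ.2 b c d
    have h5 := ξ.2 c b d
    have h6 := hc b c
    rw [mul_left_comm c b d] at h2
    rw [mul_comm c b] at h5
    linear_combination -h1 + h2 + h3 - h5 + h6
  -- This compares (st)^m with s^m t^m for lifts s, t. At m = n the last three terms sum to zero.
  have hm : ∀ m : ℕ, ∑ k ∈ Finset.range m, ξ.1 ((σ * τ) ^ k, σ * τ)
      = ∑ k ∈ Finset.range m, ξ.1 (σ ^ k, σ) + ∑ k ∈ Finset.range m, ξ.1 (τ ^ k, τ)
        + ξ.1 (σ ^ m, τ ^ m) - m * ξ.1 (σ, τ) - ξ.1 (1, 1) := by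
    intro m
    induction m with
    | zero => simp
    | succ m ih =>
      have := h4 (σ ^ m) (τ ^ m) σ τ
      simp only [Finset.sum_range_succ]
      rw [ih, mul_pow, pow_succ σ, pow_succ τ]
      push_cast
      linear_combination this
  rw [hm, hM, hM]
  simp

/-- Every class of 2-cocycles has a normalized representative. -/
theorem exists_normalized (h : H2 n M) :
    ∃ ξ : Z2 n M, QuotientAddGroup.mk ξ = h ∧ ξ.1 (1, 1) = 0 := by
  induction h using QuotientAddGroup.induction_on with | H ξ => ?_
  let η : Z2 n M := ⟨ContinuousMap.const _ (ξ.1 (1, 1)), fun a b c => by simp⟩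
  refine ⟨ξ - η, ?_, ?_⟩
  · have hη : (QuotientAddGroup.mk η : H2 n M) = 0 :=
      (H2_mk_eq_zero_iff η).2 ⟨ContinuousMap.const _ (ξ.1 (1, 1)), fun a b => by simp [η]⟩
    rw [QuotientAddGroup.mk_sub, hη, sub_zero]
  · simp [η]

variable [NeZero n]

theorem commForm_bockstein (σ τ : M) (z : H1 n M) : commForm σ τ (bockstein z) = 0 := by
  change carry (z (Additive.ofMul σ)) (z (Additive.ofMul τ))
    - carry (z (Additive.ofMul τ)) (z (Additive.ofMul σ)) = 0
  rw [carry, carry, add_comm (ZMod.val _), sub_self]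

/-- Adding `a` to itself n times produces n · `a.val` as an integer and 0 modulo n, so exactly
`a.val` carries occur. -/
theorem sum_carry (a : ZMod n) : ∑ k ∈ Finset.range n, carry (k • a) a = a := by
  have e : ∀ x y : ZMod n, n * ((x.val + y.val) / n) + (x + y).val = x.val + y.val := by
    intro x y; rw [ZMod.val_add]; exact Nat.div_add_mod _ _
  have h : ∀ m, n * ∑ k ∈ Finset.range m, (((k • a).val + a.val) / n) + (m • a).val
      = m * a.val := by
    intro m
    induction m with
    | zero => simp
    | succ m ih =>
      have := e (m • a) a
      rw [Finset.sum_range_succ, succ_nsmul, mul_add, add_mul, one_mul]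
      omega
  have h' := h n
  have h0 : n • a = 0 := by simp
  rw [h0, ZMod.val_zero, add_zero] at h'
  have h2 := Nat.eq_of_mul_eq_mul_left (NeZero.pos n) h'
  calc ∑ k ∈ Finset.range n, carry (k • a) a
      = ((∑ k ∈ Finset.range n, (((k • a).val + a.val) / n) : ℕ) : ZMod n) := by
        rw [Nat.cast_sum]; rfl
    _ = a := by rw [h2, ZMod.natCast_zmod_val]

theorem powForm_bockstein (hM : ∀ a : M, a ^ n = 1) (σ : M) (z : H1 n M) :
    powForm hM σ (bockstein z) = z (Additive.ofMul σ) := by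
  change ∑ k ∈ Finset.range n, carry (z (Additive.ofMul (σ ^ k))) (z (Additive.ofMul σ)) = _
  simp only [ofMul_pow, map_nsmul]
  exact sum_carry _

end Invariants

/-! ### Extensions with vanishing forms split continuously. -/

section Splitting

/-- The set underlying the central extension of `M` by `ℤ/n` with factor set `f`. -/
@[ext]
structure CentralExt {n : ℕ} {M : Type*} (f : M → M → ZMod n) where
  /-- The image in `M`. -/
  fst : M
  /-- The coordinate in `ℤ/n`. -/
  snd : ZMod n

/-- The abelian group structure on the central extension given by a symmetric normalized
2-cocycle. -/
abbrev CentralExt.addCommGroup {n : ℕ} {M : Type*} [CommGroup M] (f : M → M → ZMod n)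
    (hf : ∀ a b c, f b c - f (a * b) c + f a (b * c) - f a b = 0) (hs : ∀ a b, f a b = f b a)
    (h1 : f 1 1 = 0) : AddCommGroup (CentralExt f) :=
  have h2 : ∀ a, f 1 a = 0 := fun a => by
    have := hf 1 1 a
    simp only [one_mul] at this
    linear_combination this + h1
  letI : Add (CentralExt f) := ⟨fun p q => ⟨p.1 * q.1, p.2 + q.2 + f p.1 q.1⟩⟩
  letI : Zero (CentralExt f) := ⟨⟨1, 0⟩⟩
  letI : Neg (CentralExt f) := ⟨fun p => ⟨p.1⁻¹, -p.2 - f p.1⁻¹ p.1⟩⟩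
  { AddGroup.ofLeftAxioms
      (fun p q r => CentralExt.ext (mul_assoc _ _ _) (by
        change p.2 + q.2 + f p.1 q.1 + r.2 + f (p.1 * q.1) r.1
          = p.2 + (q.2 + r.2 + f q.1 r.1) + f p.1 (q.1 * r.1)
        linear_combination -hf p.1 q.1 r.1))
      (fun p => CentralExt.ext (one_mul _) (by
        change 0 + p.2 + f 1 p.1 = p.2
        rw [h2]; ring))
      (fun p => CentralExt.ext (inv_mul_cancel _) (by
        change -p.2 - f p.1⁻¹ p.1 + p.2 + f p.1⁻¹ p.1 = 0
        ring)) with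
    add_comm := fun p q => CentralExt.ext (mul_comm _ _) (by
      change p.2 + q.2 + f p.1 q.1 = q.2 + p.2 + f q.1 p.1
      rw [hs]; ring) }

/-- A continuous function on the square of a profinite group is invariant under translations by
a small open subgroup. -/
theorem exists_openNormalSubgroup_invariant {M : Type*} [Group M] [TopologicalSpace M]
    [IsTopologicalGroup M] [CompactSpace M] [TotallyDisconnectedSpace M] {X : Type*}
    [TopologicalSpace X] [DiscreteTopology X] (F : C(M × M, X)) :
    ∃ U : OpenNormalSubgroup M, ∀ u ∈ U, ∀ a b,
      F (a * u, b) = F (a, b) ∧ F (a, b * u) = F (a, b) := by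
  -- The condition holds at u = 1 for every p and is open in (u, p). Compactness of M × M makes the
  -- neighbourhood of 1 uniform in p.
  have h : ∀ᶠ u in nhds (1 : M), ∀ p ∈ (Set.univ : Set (M × M)),
      F (p.1 * u, p.2) = F (p.1, p.2) ∧ F (p.1, p.2 * u) = F (p.1, p.2) := by
    refine isCompact_univ.eventually_forall_of_forall_eventually fun p _ => ?_
    have hc : Continuous fun z : M × (M × M) =>
        (F (z.2.1 * z.1, z.2.2), F (z.2.1, z.2.2), F (z.2.1, z.2.2 * z.1)) := by fun_prop
    refine (hc.continuousAt (x := (1, p))).eventually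
      (p := fun w : X × X × X => w.1 = w.2.1 ∧ w.2.2 = w.2.1) ?_
    refine (isOpen_discrete {w : X × X × X | w.1 = w.2.1 ∧ w.2.2 = w.2.1}).mem_nhds ?_
    simp
  obtain ⟨W, hW, hWo, h1⟩ := mem_nhds_iff.1 h
  obtain ⟨U, hU⟩ := ProfiniteGrp.exist_openNormalSubgroup_sub_open_nhds_of_one hWo h1
  exact ⟨U, fun u hu a b => hW (hU hu) (a, b) trivial⟩

/-- A class in `H²` of an abelian profinite group of exponent `n` whose commutator and power forms
vanish is trivial. -/
theorem H2_eq_zero_of_forms {n : ℕ} [NeZero n] {M : Type*} [CommGroup M] [TopologicalSpace M]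
    [IsTopologicalGroup M] [CompactSpace M] [TotallyDisconnectedSpace M]
    (hM : ∀ a : M, a ^ n = 1) (h : H2 n M) (hc : ∀ σ τ, commForm σ τ h = 0)
    (hp : ∀ σ, powForm hM σ h = 0) : h = 0 := by
  obtain ⟨ξ, rfl, h11⟩ := exists_normalized h
  simp only [commForm_mk, powForm_mk, sub_eq_zero] at hc hp
  let f : M → M → ZMod n := fun a b => ξ.1 (a, b)
  let _ : AddCommGroup (CentralExt f) := CentralExt.addCommGroup f ξ.2 hc h11
  have hadd : ∀ p q : CentralExt f, p + q = ⟨p.1 * q.1, p.2 + q.2 + f p.1 q.1⟩ := fun _ _ => rfl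
  have hzero : (0 : CentralExt f) = ⟨1, 0⟩ := rfl
  have hneg : ∀ p : CentralExt f, -p = ⟨p.1⁻¹, -p.2 - f p.1⁻¹ p.1⟩ := fun _ => rfl
  have hl : ∀ a, f 1 a = 0 := fun a => (Z2_apply_one_left ξ a).trans h11
  have hr : ∀ a, f a 1 = 0 := fun a => (Z2_apply_one_right ξ a).trans h11
  -- The second coordinate of n • p is n times the old one plus the power form, so both
  -- contributions vanish.
  have hkill : ∀ p : CentralExt f, n • p = 0 := by
    intro p
    have : ∀ m : ℕ, m • p = ⟨p.1 ^ m, m * p.2 + ∑ k ∈ Finset.range m, f (p.1 ^ k) p.1⟩ := by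
      intro m
      induction m with
      | zero => simp [hzero]
      | succ m ih =>
        rw [succ_nsmul, ih, hadd, Finset.sum_range_succ, pow_succ]
        congr 1
        push_cast
        ring
    rw [this, hM, hzero]
    congr 1
    rw [hp]
    simp
  obtain ⟨U, hU⟩ := exists_openNormalSubgroup_invariant ξ.1
  have hU1 : ∀ u ∈ U, ∀ a, f u a = 0 := fun u hu a => by
    have := (hU u hu 1 a).1
    rw [one_mul] at this
    exact this.trans (hl a)
  -- On the open subgroup U the cocycle vanishes, so U lifts to the subgroup N of the extension.
  -- Retracting the quotient by N onto ℤ/n, rather than the extension itself, is what makes the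
  -- splitting continuous.
  let N : AddSubgroup (CentralExt f) :=
    { carrier := {p | p.1 ∈ U ∧ p.2 = 0}
      zero_mem' := ⟨one_mem U, rfl⟩
      add_mem' := by
        rintro p q ⟨hp, hp'⟩ ⟨hq, hq'⟩
        rw [hadd]
        exact ⟨mul_mem hp hq, by simp [hp', hq', hU1 _ hp]⟩
      neg_mem' := by
        rintro p ⟨hp, hp'⟩
        rw [hneg]
        exact ⟨inv_mem hp, by simp [hp', hU1 _ (inv_mem hp)]⟩ }
  let q : ZMod n →+ CentralExt f ⧸ N :=
    (QuotientAddGroup.mk' N).comp (AddMonoidHom.mk' (fun l => (⟨1, l⟩ : CentralExt f))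
      fun l l' => by rw [hadd]; simp [hl])
  obtain ⟨ρ, hρ⟩ := exists_hom_zmod_extension (n := n) (A := CentralExt f ⧸ N) (by
    intro a
    induction a using QuotientAddGroup.induction_on with | H p => ?_
    rw [← QuotientAddGroup.mk_nsmul, hkill, QuotientAddGroup.mk_zero]) q (AddMonoidHom.id _) (by
    intro l hl
    exact ((QuotientAddGroup.eq_zero_iff _).1 hl).2)
  -- ρ retracts the extension onto ℤ/n. Since (a, 0) + (b, 0) = (ab, 0) + (1, f(a, b)), applying ρ
  -- to the zero section gives a cochain bounding f.
  let w : M → ZMod n := fun a => ρ (QuotientAddGroup.mk (⟨a, 0⟩ : CentralExt f))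
  have hw : ∀ a b, w a + w b = w (a * b) + f a b := by
    intro a b
    have h1 := hρ (f a b)
    change ρ (QuotientAddGroup.mk (⟨1, f a b⟩ : CentralExt f)) = f a b at h1
    rw [← h1, ← map_add, ← map_add, ← QuotientAddGroup.mk_add, ← QuotientAddGroup.mk_add,
      hadd, hadd]
    simp [hr]
  have hwU : ∀ a, ∀ u ∈ U, w (a * u) = w a := by
    intro a u hu
    have h1 := hw a u
    have h2 : w u = 0 := by
      have : (QuotientAddGroup.mk (⟨u, 0⟩ : CentralExt f) : CentralExt f ⧸ N) = 0 :=
        (QuotientAddGroup.eq_zero_iff _).2 ⟨hu, rfl⟩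
      change ρ _ = 0
      rw [this, map_zero]
    have h3 : f a u = 0 := (hc a u).trans (hU1 u hu a)
    rw [h2, h3] at h1
    simpa using h1.symm
  have hwc : Continuous w := by
    refine (IsLocallyConstant.iff_eventually_eq w).2 (fun a => ?_) |>.continuous
    have : {b | a⁻¹ * b ∈ U} ∈ nhds a := by
      refine (U.isOpen'.preimage (continuous_const_mul a⁻¹)).mem_nhds ?_
      simp
    filter_upwards [this] with b hb
    have := hwU a _ hb
    rwa [mul_inv_cancel_left] at this
  refine (H2_mk_eq_zero_iff ξ).2 ⟨⟨w, hwc⟩, fun a b => ?_⟩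
  have := hw a b
  change f a b = w b - w (a * b) + w a
  linear_combination -this

end Splitting

/-! ### Generators of H² and its homomorphisms to ℤ/n, in coordinates. -/

section Coordinates

open Filter Topology

variable {n : ℕ} {M : Type*} [CommGroup M] [TopologicalSpace M] {I : Type*}
  (e : M ≃ₜ* Multiplicative (I → ZMod n))

open Classical in
/-- The topological basis of `M` given by an isomorphism with a power of `ℤ/n`. -/
def basisElt (i : I) : M := e.symm (Multiplicative.ofAdd (Pi.single i 1))

/-- The coordinate homomorphisms given by an isomorphism with a power of `ℤ/n`. -/
def coordHom (i : I) : H1 n M where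
  toFun a := (e a.toMul).toAdd i
  map_zero' := by simp
  map_add' a b := by simp
  continuous_toFun := (continuous_apply i).comp
    (continuous_toAdd.comp (e.continuous_toFun.comp continuous_toMul))

open Classical in
theorem coordHom_basisElt (i j : I) :
    coordHom e i (Additive.ofMul (basisElt e j)) = if i = j then 1 else 0 := by
  simp only [coordHom, basisElt]
  change (e (e.symm _)).toAdd i = _
  rw [ContinuousMulEquiv.apply_symm_apply, toAdd_ofAdd, Pi.single_apply]

theorem coordHom_ofAdd_symm (i : I) (v : I → ZMod n) :
    coordHom e i (Additive.ofMul (e.symm (Multiplicative.ofAdd v))) = v i := by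
  change (e (e.symm _)).toAdd i = _
  rw [ContinuousMulEquiv.apply_symm_apply, toAdd_ofAdd]

theorem pow_eq_one_of_equiv (e : M ≃ₜ* Multiplicative (I → ZMod n)) (a : M) : a ^ n = 1 := by
  apply e.injective
  rw [map_pow, map_one]
  apply Multiplicative.toAdd.injective
  ext i
  simp

theorem H1_coe_sum {ι : Type*} (s : Finset ι) (x : ι → H1 n M) (a : Additive M) :
    (∑ i ∈ s, x i) a = ∑ i ∈ s, x i a := by
  classical
  induction s using Finset.induction_on with
  | empty => rfl
  | insert i s hi ih =>
    rw [Finset.sum_insert hi, Finset.sum_insert hi, ← ih]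
    rfl

theorem H1_coe_nsmul (k : ℕ) (x : H1 n M) (a : Additive M) : (k • x) a = k • x a := by
  induction k with
  | zero => simp
  | succ k ih =>
    rw [succ_nsmul, succ_nsmul, ← ih]
    rfl

/-- Each coordinate is nonzero on only one unit vector. This is the source of the finiteness
statements below: a continuous discrete-valued function that is 0 at 1 vanishes on almost all basis
elements. -/
theorem tendsto_basisElt : Tendsto (basisElt e) cofinite (𝓝 1) := by
  classical
  have h : Tendsto (fun i => (Pi.single i 1 : I → ZMod n)) cofinite (𝓝 0) := by
    rw [tendsto_pi_nhds]
    intro j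
    refine tendsto_const_nhds.congr' ?_
    have : ({j}ᶜ : Set I) ∈ cofinite := (Set.finite_singleton j).compl_mem_cofinite
    filter_upwards [this] with i hi
    rw [Pi.zero_apply, Pi.single_eq_of_ne]
    exact fun h => hi h.symm
  have h2 := (e.symm.continuous_toFun.comp (continuous_ofAdd (X := I → ZMod n))).tendsto 0
  have h3 := h2.comp h
  have h4 : (e.symm.toFun ∘ Multiplicative.ofAdd) (0 : I → ZMod n) = 1 := map_one e.symm
  rw [h4] at h3
  exact h3

theorem finite_H1_support (x : H1 n M) : {i | x (Additive.ofMul (basisElt e i)) ≠ 0}.Finite := by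
  have h1 : Continuous fun a : M => x (Additive.ofMul a) := x.continuous_toFun.comp continuous_ofMul
  have h := (h1.tendsto 1).comp (tendsto_basisElt e)
  have h0 : x (Additive.ofMul 1) = 0 := map_zero x
  rw [h0, nhds_discrete, tendsto_pure] at h
  exact h

section

variable [IsTopologicalGroup M]

open Classical in
theorem commForm_basis_cup (i j k l : I) :
    commForm (basisElt e i) (basisElt e j) (cup (coordHom e k) (coordHom e l)) =
      (if k = i ∧ l = j then 1 else 0) - (if k = j ∧ l = i then 1 else 0) := by
  simp only [commForm_cup, coordHom_basisElt]
  split_ifs <;> simp_all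

open Classical in
theorem powForm_basis_cup (i k l : I) :
    powForm (pow_eq_one_of_equiv e) (basisElt e i) (cup (coordHom e k) (coordHom e l)) =
      if k = i ∧ l = i then (n.choose 2 : ZMod n) else 0 := by
  simp only [powForm_cup, coordHom_basisElt]
  split_ifs <;> simp_all

theorem finite_powForm_support (h : H2 n M) :
    {i | powForm (pow_eq_one_of_equiv e) (basisElt e i) h ≠ 0}.Finite := by
  have h1 := ((continuous_powForm (pow_eq_one_of_equiv e) h).tendsto 1).comp (tendsto_basisElt e)
  have h0 : powForm (pow_eq_one_of_equiv e) 1 h = 0 := by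
    induction h using QuotientAddGroup.induction_on with | H ξ => ?_
    simp [powForm_mk]
  rw [h0, nhds_discrete, tendsto_pure] at h1
  exact h1

variable [CompactSpace M]

/-- The form vanishes at σ = 1 for all τ. By compactness it does so for all σ near 1, uniformly in
τ, and almost all basis elements are near 1. -/
theorem finite_commForm_left_support (h : H2 n M) :
    {i | ∃ τ, commForm (basisElt e i) τ h ≠ 0}.Finite := by
  have h0 : ∀ τ : M, commForm 1 τ h = 0 := fun τ => by
    have := commForm_mul_left 1 1 τ h
    rw [one_mul] at this
    simpa using this
  have h1 : ∀ᶠ σ in 𝓝 (1 : M), ∀ τ ∈ (Set.univ : Set M), commForm σ τ h = 0 := by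
    refine isCompact_univ.eventually_forall_of_forall_eventually fun τ _ => ?_
    refine ((continuous_commForm h).continuousAt (x := (1, τ))).eventually (p := fun w => w = 0) ?_
    rw [nhds_discrete]
    exact h0 τ
  have h2 := (tendsto_basisElt e).eventually h1
  refine Set.Finite.subset h2 fun i => ?_
  rintro ⟨τ, hτ⟩ hi
  exact hτ (hi τ trivial)

theorem finite_commForm_support (h : H2 n M) :
    {p : I × I | commForm (basisElt e p.1) (basisElt e p.2) h ≠ 0}.Finite := by
  refine ((finite_commForm_left_support e h).prod (finite_commForm_left_support e h)).subset ?_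
  rintro ⟨i, j⟩ hij
  refine ⟨⟨_, hij⟩, ⟨basisElt e i, ?_⟩⟩
  rw [commForm_swap, neg_ne_zero]
  exact hij

end

variable [NeZero n]

/-- A continuous homomorphism to `ℤ/n` that vanishes on the topological basis is trivial. -/
theorem eq_zero_of_basisElt {y : M → ZMod n} (hy : Continuous y)
    (hmul : ∀ a b, y (a * b) = y a + y b) (h0 : ∀ i, y (basisElt e i) = 0) (a : M) : y a = 0 := by
  classical
  let z : (I → ZMod n) →+ ZMod n := AddMonoidHom.mk'
    (fun v => y (e.symm (Multiplicative.ofAdd v))) fun v w => by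
      rw [ofAdd_add, map_mul, hmul]
  have hz : Continuous z := hy.comp (e.symm.continuous_toFun.comp continuous_ofAdd)
  have h1 : ∀ i (k : ZMod n), z (Pi.single i k) = 0 := by
    intro i k
    have : (Pi.single i k : I → ZMod n) = k.val • Pi.single i (1 : ZMod n) := by
      rw [← Pi.single_smul]
      simp
    rw [this, map_nsmul]
    change k.val • y (basisElt e i) = 0
    rw [h0, smul_zero]
  -- Every vector is the convergent sum of its coordinate vectors, so a continuous homomorphism is
  -- determined on these.
  have hs : ∀ v : I → ZMod n, HasSum (fun i => Pi.single i (v i)) v := by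
    intro v
    rw [Pi.hasSum]
    intro j
    have := hasSum_single (f := fun i => (Pi.single i (v i) : I → ZMod n) j) j
      fun i hi => Pi.single_eq_of_ne (Ne.symm hi) _
    simpa using this
  have h2 : ∀ v, z v = 0 := by
    intro v
    have h3 := (hs v).map z hz
    have h4 : (z ∘ fun i => Pi.single i (v i)) = fun _ => 0 := funext fun i => h1 i _
    rw [h4] at h3
    exact h3.unique hasSum_zero
  have := h2 (e a).toAdd
  change y (e.symm (e a)) = 0 at this
  rwa [ContinuousMulEquiv.symm_apply_apply] at this

theorem H1_ext_basis {x y : H1 n M}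
    (h : ∀ i, x (Additive.ofMul (basisElt e i)) = y (Additive.ofMul (basisElt e i))) : x = y := by
  ext a
  have := eq_zero_of_basisElt e (y := fun a : M => x (Additive.ofMul a) - y (Additive.ofMul a))
    ((x.continuous_toFun.comp continuous_ofMul).sub (y.continuous_toFun.comp continuous_ofMul))
    (fun a b => by simp only [ofMul_mul, map_add]; ring) (fun i => sub_eq_zero.2 (h i)) a.toMul
  exact sub_eq_zero.1 this

theorem closure_coordHom : AddSubgroup.closure (Set.range (coordHom e)) = ⊤ := by
  classical
  rw [eq_top_iff]
  intro x _
  let F := (finite_H1_support e x).toFinset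
  have : x = ∑ i ∈ F, (x (Additive.ofMul (basisElt e i))).val • coordHom e i := by
    refine H1_ext_basis e fun j => ?_
    rw [H1_coe_sum]
    simp only [H1_coe_nsmul, coordHom_basisElt, nsmul_eq_mul, ZMod.natCast_zmod_val, mul_ite,
      mul_one, mul_zero, Finset.sum_ite_eq']
    split_ifs with hj
    · rfl
    · simpa [F] using hj
  rw [this]
  exact sum_mem fun i _ => nsmul_mem (AddSubgroup.subset_closure (Set.mem_range_self i)) _

theorem H1_hom_ext {A : Type*} [AddCommGroup A] {θ θ' : H1 n M →+ A}
    (h : ∀ i, θ (coordHom e i) = θ' (coordHom e i)) : θ = θ' := by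
  refine AddMonoidHom.eq_of_eqOn_dense (closure_coordHom e) ?_
  rintro _ ⟨i, rfl⟩
  exact h i

variable [IsTopologicalGroup M]

open Classical in
theorem powForm_basis_bockstein (i k : I) :
    powForm (pow_eq_one_of_equiv e) (basisElt e i) (bockstein (coordHom e k)) =
      if k = i then 1 else 0 := by
  rw [powForm_bockstein, coordHom_basisElt]

variable [CompactSpace M] [TotallyDisconnectedSpace M]

/-- The commutator form is biadditive and continuous, so it vanishes everywhere. Only then is the
power form additive, so that its values on the basis suffice too. -/
theorem H2_eq_zero_of_basis (h : H2 n M)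
    (hc : ∀ i j, commForm (basisElt e i) (basisElt e j) h = 0)
    (hp : ∀ i, powForm (pow_eq_one_of_equiv e) (basisElt e i) h = 0) : h = 0 := by
  have hc1 : ∀ i τ, commForm (basisElt e i) τ h = 0 := fun i τ =>
    eq_zero_of_basisElt e (y := fun τ => commForm (basisElt e i) τ h)
      ((continuous_commForm h).comp (by fun_prop : Continuous fun τ : M => (basisElt e i, τ)))
      (fun a b => commForm_mul_right _ _ _ _) (hc i) τ
  have hc2 : ∀ σ τ, commForm σ τ h = 0 := fun σ τ =>
    eq_zero_of_basisElt e (y := fun σ => commForm σ τ h)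
      ((continuous_commForm h).comp (by fun_prop : Continuous fun σ : M => (σ, τ)))
      (fun a b => commForm_mul_left _ _ _ _) (fun i => hc1 i τ) σ
  refine H2_eq_zero_of_forms (pow_eq_one_of_equiv e) h hc2 fun σ => ?_
  refine eq_zero_of_basisElt e (y := fun σ => powForm (pow_eq_one_of_equiv e) σ h)
    (continuous_powForm _ h) (powForm_mul _ h hc2) hp σ

/-- `β` is additive. -/
theorem bockstein_add (e : M ≃ₜ* Multiplicative (I → ZMod n)) (x y : H1 n M) :
    bockstein (x + y) = bockstein x + bockstein y := by
  rw [← sub_eq_zero]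
  refine H2_eq_zero_of_basis e _ (fun i j => ?_) fun i => ?_
  · simp only [map_sub, map_add, commForm_bockstein, add_zero, sub_zero]
  · simp only [map_sub, map_add, powForm_bockstein]
    exact sub_self _

/-- The Bockstein map as a homomorphism. -/
def bocksteinHom : H1 n M →+ H2 n M := AddMonoidHom.mk' bockstein (bockstein_add e)

/-- Both sides have zero commutator form, and their power forms agree because (n choose 2) a² = (n
choose 2) a in ℤ/n. This relation is where the condition defining `Sfr` comes from. -/
theorem cup_self (e : M ≃ₜ* Multiplicative (I → ZMod n)) (x : H1 n M) :
    cup x x = n.choose 2 • bockstein x := by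
  rw [← sub_eq_zero]
  refine H2_eq_zero_of_basis e _ (fun i j => ?_) fun i => ?_
  · rw [map_sub, map_nsmul, commForm_bockstein, commForm_cup]
    ring
  · rw [map_sub, map_nsmul, powForm_bockstein, powForm_cup, nsmul_eq_mul]
    obtain ⟨a, ha⟩ := ZMod.intCast_surjective (x (Additive.ofMul (basisElt e i)))
    rw [← ha, choose_two_mul_sq, sub_self]

/-- `H²` is generated by the cup products and the values of the Bockstein map on the coordinates. -/
theorem closure_cup_bockstein :
    AddSubgroup.closure ((Set.range fun p : I × I => cup (coordHom e p.1) (coordHom e p.2)) ∪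
      Set.range fun i => bockstein (coordHom e i)) = ⊤ := by
  classical
  -- A linear order on I selects one cup product for each unordered pair of distinct indices.
  obtain ⟨_, -⟩ := exists_wellFoundedLT I
  rw [eq_top_iff]
  intro h _
  set S := AddSubgroup.closure ((Set.range fun p : I × I =>
    cup (coordHom e p.1) (coordHom e p.2)) ∪ Set.range fun i => bockstein (coordHom e i))
  have hcup : ∀ i j, cup (coordHom e i) (coordHom e j) ∈ S := fun i j =>
    AddSubgroup.subset_closure (Or.inl (Set.mem_range_self (i, j)))
  have hβ : ∀ i, bockstein (coordHom e i) ∈ S := fun i =>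
    AddSubgroup.subset_closure (Or.inr (Set.mem_range_self i))
  let C : I × I → ZMod n := fun p => commForm (basisElt e p.1) (basisElt e p.2) h
  let F : Finset (I × I) := (finite_commForm_support e h).toFinset.filter fun p => p.1 < p.2
  have hF : ∀ i j, i < j → ((i, j) ∉ F → C (i, j) = 0) := by
    intro i j hij hn
    by_contra h0
    exact hn (Finset.mem_filter.2 ⟨(Set.Finite.mem_toFinset _).2 h0, hij⟩)
  -- η has the same commutator form as h on the basis. Bocksteins have zero commutator form, so ζ
  -- below can correct the power form without disturbing this.
  let η : H2 n M := ∑ p ∈ F, (C p).val • cup (coordHom e p.1) (coordHom e p.2)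
  have hη : η ∈ S := sum_mem fun p _ => nsmul_mem (hcup _ _) _
  have hlt : ∀ i j, i < j → commForm (basisElt e i) (basisElt e j) η = C (i, j) := by
    intro i j hij
    simp only [η, map_sum, map_nsmul, commForm_basis_cup]
    rw [Finset.sum_eq_single (i, j)]
    · have : ¬ (i = j ∧ j = i) := fun h => hij.ne h.1
      simp [this]
    · rintro ⟨k, l⟩ hkl hne
      have h1 : ¬ (k = i ∧ l = j) := fun h => hne (Prod.ext h.1 h.2)
      have h2 : ¬ (k = j ∧ l = i) := fun h => by
        have := (Finset.mem_filter.1 hkl).2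
        simp only [h.1, h.2] at this
        exact absurd hij this.asymm
      simp [h1, h2]
    · intro hn
      rw [hF i j hij hn]
      simp
  have hall : ∀ i j, commForm (basisElt e i) (basisElt e j) (h - η) = 0 := by
    intro i j
    rw [map_sub]
    rcases lt_trichotomy i j with hij | rfl | hij
    · rw [hlt i j hij]
      exact sub_self _
    · rw [commForm_self, commForm_self, sub_self]
    · rw [commForm_swap, commForm_swap _ _ η, hlt j i hij]
      exact sub_self _
  let Q : I → ZMod n := fun i => powForm (pow_eq_one_of_equiv e) (basisElt e i) (h - η)
  let E : Finset I := (finite_powForm_support e (h - η)).toFinset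
  let ζ : H2 n M := ∑ i ∈ E, (Q i).val • bockstein (coordHom e i)
  have hζ : ζ ∈ S := sum_mem fun p _ => nsmul_mem (hβ _) _
  have h0 : h - η - ζ = 0 := by
    refine H2_eq_zero_of_basis e _ (fun i j => ?_) fun i => ?_
    · rw [map_sub, hall]
      simp [ζ, map_sum, commForm_bockstein]
    · rw [map_sub]
      simp only [ζ, map_sum, map_nsmul, powForm_basis_bockstein, nsmul_eq_mul,
        ZMod.natCast_zmod_val, mul_ite, mul_one, mul_zero, Finset.sum_ite_eq']
      split_ifs with hi
      · exact sub_self _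
      · rw [sub_zero]
        by_contra hne
        exact hi ((Set.Finite.mem_toFinset _).2 hne)
  have : h = η + ζ := by
    rw [sub_sub, sub_eq_zero] at h0
    exact h0
  rw [this]
  exact add_mem hη hζ

theorem H2_hom_ext {A : Type*} [AddCommGroup A] {θ θ' : H2 n M →+ A}
    (hcup : ∀ i j, θ (cup (coordHom e i) (coordHom e j)) = θ' (cup (coordHom e i) (coordHom e j)))
    (hβ : ∀ i, θ (bockstein (coordHom e i)) = θ' (bockstein (coordHom e i))) : θ = θ' := by
  refine AddMonoidHom.eq_of_eqOn_dense (closure_cup_bockstein e) ?_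
  rintro _ (⟨p, rfl⟩ | ⟨i, rfl⟩)
  · exact hcup p.1 p.2
  · exact hβ i

/-- The cup product as a biadditive map. -/
def cupHom {n : ℕ} {M : Type*} [CommGroup M] [TopologicalSpace M] [IsTopologicalGroup M] :
    H1 n M →+ H1 n M →+ H2 n M :=
  AddMonoidHom.mk' (fun x => AddMonoidHom.mk' (fun y => cup x y) fun y y' => by
    unfold cup
    rw [← QuotientAddGroup.mk_add]
    refine congrArg _ (Subtype.ext (ContinuousMap.ext fun p => ?_))
    exact mul_add _ _ _) fun x x' => by
    ext y
    change cup (x + x') y = cup x y + cup x' y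
    unfold cup
    rw [← QuotientAddGroup.mk_add]
    refine congrArg _ (Subtype.ext (ContinuousMap.ext fun p => ?_))
    exact add_mul _ _ _

/-- Homomorphisms `H² → ℤ/n` agree with the pairs of forms `(B, γ)` that satisfy
`B(x, x) = (n choose 2) γ(x)`. -/
theorem exists_H2_hom (e : M ≃ₜ* Multiplicative (I → ZMod n)) (B : H1 n M →+ H1 n M →+ ZMod n)
    (γ : H1 n M →+ ZMod n) (hB : ∀ x, B x x = (n.choose 2 : ZMod n) * γ x) :
    ∃ θ : H2 n M →+ ZMod n, (∀ x y, θ (cup x y) = B x y) ∧ ∀ z, θ (bockstein z) = γ z := by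
  classical
  obtain ⟨_, -⟩ := exists_wellFoundedLT I
  let b : I × I → ZMod n := fun p =>
    if p.1 < p.2 then B (coordHom e p.1) (coordHom e p.2) else 0
  have hf1 : ∀ h : H2 n M, (Function.support fun p : I × I =>
      b p * commForm (basisElt e p.1) (basisElt e p.2) h).Finite := fun h =>
    (finite_commForm_support e h).subset fun p hp h0 => hp (by simp only [h0, mul_zero])
  have hf2 : ∀ h : H2 n M, (Function.support fun i : I =>
      γ (coordHom e i) * powForm (pow_eq_one_of_equiv e) (basisElt e i) h).Finite := fun h =>
    (finite_powForm_support e h).subset fun p hp h0 => hp (by simp only [h0, mul_zero])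
  -- The commutator form at basis elements i < j and the power form at i are dual to the generating
  -- cup products and Bocksteins, so B and γ serve as coefficients. For a fixed class only finitely
  -- many terms are nonzero.
  let θ : H2 n M →+ ZMod n := AddMonoidHom.mk' (fun h =>
    (∑ᶠ p : I × I, b p * commForm (basisElt e p.1) (basisElt e p.2) h) +
      ∑ᶠ i, γ (coordHom e i) * powForm (pow_eq_one_of_equiv e) (basisElt e i) h) fun h h' => by
    simp only [map_add, mul_add]
    rw [finsum_add_distrib (hf1 h) (hf1 h'), finsum_add_distrib (hf2 h) (hf2 h')]
    ring
  have hθ : ∀ h, θ h = (∑ᶠ p : I × I, b p * commForm (basisElt e p.1) (basisElt e p.2) h) +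
      ∑ᶠ i, γ (coordHom e i) * powForm (pow_eq_one_of_equiv e) (basisElt e i) h := fun _ => rfl
  -- Polarizing `hB` shows that B is antisymmetric, which settles the pairs with k > l. The diagonal
  -- pairs come from `hB` itself.
  have hanti : ∀ i j,
      B (coordHom e i) (coordHom e j) + B (coordHom e j) (coordHom e i) = 0 := by
    intro i j
    have h := hB (coordHom e i + coordHom e j)
    simp only [map_add, AddMonoidHom.add_apply, hB] at h
    linear_combination h
  have hcup : ∀ k l, θ (cup (coordHom e k) (coordHom e l)) = B (coordHom e k) (coordHom e l) := by
    intro k l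
    rw [hθ]
    simp only [commForm_basis_cup, powForm_basis_cup]
    rcases lt_trichotomy k l with hkl | rfl | hkl
    · rw [finsum_eq_single _ (k, l), finsum_eq_zero_of_forall_eq_zero]
      · simp [b, hkl, hkl.ne]
      · intro i
        have : ¬ (k = i ∧ l = i) := fun h => hkl.ne (h.1.trans h.2.symm)
        simp [this]
      · rintro ⟨i, j⟩ hne
        have h1 : ¬ (k = i ∧ l = j) := fun h => hne (Prod.ext h.1.symm h.2.symm)
        rw [if_neg h1]
        by_cases h2 : k = j ∧ l = i
        · have : ¬ i < j := by
            rw [← h2.1, ← h2.2]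
            exact hkl.asymm
          simp [b, this]
        · simp [h2]
    · rw [finsum_eq_zero_of_forall_eq_zero, finsum_eq_single _ k]
      · simp only [and_self, if_true, zero_add, hB]
        ring
      · intro i hi
        simp [Ne.symm hi]
      · rintro ⟨i, j⟩
        rw [← commForm_basis_cup e, commForm_cup]
        ring
    · rw [finsum_eq_single _ (l, k), finsum_eq_zero_of_forall_eq_zero]
      · simp only [b, hkl, if_true, hkl.ne, hkl.ne', and_self, if_false]
        linear_combination -hanti k l
      · intro i
        have : ¬ (k = i ∧ l = i) := fun h => hkl.ne (h.2.trans h.1.symm)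
        simp [this]
      · rintro ⟨i, j⟩ hne
        have h1 : ¬ (k = j ∧ l = i) := fun h => hne (Prod.ext h.2.symm h.1.symm)
        rw [if_neg h1]
        by_cases h2 : k = i ∧ l = j
        · have : ¬ i < j := by
            rw [← h2.1, ← h2.2]
            exact hkl.asymm
          simp [b, this]
        · simp [h2]
  have hβ : ∀ k, θ (bockstein (coordHom e k)) = γ (coordHom e k) := by
    intro k
    rw [hθ]
    simp only [commForm_bockstein, powForm_basis_bockstein]
    rw [finsum_eq_zero_of_forall_eq_zero (fun p => mul_zero _), finsum_eq_single _ k]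
    · simp
    · intro i hi
      simp [Ne.symm hi]
  refine ⟨θ, fun x y => ?_, fun z => ?_⟩
  · have : cupHom.compr₂ θ = B := by
      refine H1_hom_ext e fun i => H1_hom_ext e fun j => hcup i j
    exact DFunLike.congr_fun (DFunLike.congr_fun this x) y
  · have : θ.comp (bocksteinHom e) = γ := H1_hom_ext e hβ
    exact DFunLike.congr_fun this z

end Coordinates

/-! ### Elements of the completed tensor square as bilinear forms. -/

section CompletedTensor

open Filter Topology

variable {n : ℕ} {A : Type*} [AddCommGroup A] [Module (ZMod n) A] [TopologicalSpace A]

/-- The homomorphism `A / N → ℤ/n` induced by a homomorphism that vanishes on `N`. -/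
def quotHom (x : A →ₜ+ ZMod n) (N : OpenSub n A) (h : N.1 ≤ (openKer x).1) :
    (A ⧸ N.1) →ₗ[ZMod n] ZMod n :=
  N.1.liftQ ((x : A →+ ZMod n).toZModLinearMap n) h

/-- The homomorphism `A / N₁ ⊗ A / N₂ → ℤ/n` induced by `x ⊗ y`. -/
def tensorHom (x y : A →ₜ+ ZMod n) (N₁ N₂ : OpenSub n A) (h₁ : N₁.1 ≤ (openKer x).1)
    (h₂ : N₂.1 ≤ (openKer y).1) : (A ⧸ N₁.1) ⊗[ZMod n] (A ⧸ N₂.1) →ₗ[ZMod n] ZMod n :=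
  TensorProduct.lift ((LinearMap.mul (ZMod n) (ZMod n)).compl₁₂ (quotHom x N₁ h₁) (quotHom y N₂ h₂))

theorem tensorHom_tmul (x y : A →ₜ+ ZMod n) (N₁ N₂ : OpenSub n A) (h₁ : N₁.1 ≤ (openKer x).1)
    (h₂ : N₂.1 ≤ (openKer y).1) (σ τ : A) :
    tensorHom x y N₁ N₂ h₁ h₂ (N₁.1.mkQ σ ⊗ₜ N₂.1.mkQ τ) = x σ * y τ := rfl

theorem tensor_hom_ext {n : ℕ} {A : Type*} [AddCommGroup A] [Module (ZMod n) A]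
    {N₁ N₂ : Submodule (ZMod n) A}
    {φ ψ : (A ⧸ N₁) ⊗[ZMod n] (A ⧸ N₂) →ₗ[ZMod n] ZMod n}
    (h : ∀ σ τ, φ (N₁.mkQ σ ⊗ₜ N₂.mkQ τ) = ψ (N₁.mkQ σ ⊗ₜ N₂.mkQ τ)) : φ = ψ := by
  refine TensorProduct.ext' fun a b => ?_
  obtain ⟨σ, rfl⟩ := N₁.mkQ_surjective a
  obtain ⟨τ, rfl⟩ := N₂.mkQ_surjective b
  exact h σ τ

/-- The value `f(x, y)` may be computed in `A / N₁ ⊗ A / N₂` for small enough `N₁`, `N₂`. -/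
theorem ceval_eq_tensorHom (x y : A →ₜ+ ZMod n) (N₁ N₂ : OpenSub n A)
    (h₁ : N₁.1 ≤ (openKer x).1) (h₂ : N₂.1 ≤ (openKer y).1) (f : CTensor n A) :
    ceval x y f = tensorHom x y N₁ N₂ h₁ h₂ (f.1 (N₁, N₂)) := by
  have h := f.2 (N₁, N₂) (openKer x, openKer y) h₁ h₂
  change tensorHom x y (openKer x) (openKer y) le_rfl le_rfl (f.1 (openKer x, openKer y)) = _
  rw [← h, ← LinearMap.comp_apply]
  congr 1
  exact tensor_hom_ext fun σ τ => rfl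

/-- The three values are defined at different levels of the inverse limit. They become comparable at
ker x ∩ ker x', which also lies in ker (x + x'). -/
theorem ceval_add_left (x x' y : A →ₜ+ ZMod n) (f : CTensor n A) :
    ceval (x + x') y f = ceval x y f + ceval x' y f := by
  let N : OpenSub n A := ⟨(openKer x).1 ⊓ (openKer x').1, (openKer x).2.inter (openKer x').2⟩
  have h1 : N.1 ≤ (openKer x).1 := inf_le_left
  have h2 : N.1 ≤ (openKer x').1 := inf_le_right
  have h3 : N.1 ≤ (openKer (x + x')).1 := fun a ha => by
    change x a + x' a = 0
    rw [show x a = 0 from h1 ha, show x' a = 0 from h2 ha, add_zero]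
  rw [ceval_eq_tensorHom x y N (openKer y) h1 le_rfl,
    ceval_eq_tensorHom x' y N (openKer y) h2 le_rfl,
    ceval_eq_tensorHom (x + x') y N (openKer y) h3 le_rfl, ← LinearMap.add_apply]
  congr 1
  refine tensor_hom_ext fun σ τ => ?_
  rw [LinearMap.add_apply, tensorHom_tmul, tensorHom_tmul, tensorHom_tmul, ← add_mul]
  rfl

theorem ceval_add_right (x y y' : A →ₜ+ ZMod n) (f : CTensor n A) :
    ceval x (y + y') f = ceval x y f + ceval x y' f := by
  let N : OpenSub n A := ⟨(openKer y).1 ⊓ (openKer y').1, (openKer y).2.inter (openKer y').2⟩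
  have h1 : N.1 ≤ (openKer y).1 := inf_le_left
  have h2 : N.1 ≤ (openKer y').1 := inf_le_right
  have h3 : N.1 ≤ (openKer (y + y')).1 := fun a ha => by
    change y a + y' a = 0
    rw [show y a = 0 from h1 ha, show y' a = 0 from h2 ha, add_zero]
  rw [ceval_eq_tensorHom x y (openKer x) N le_rfl h1,
    ceval_eq_tensorHom x y' (openKer x) N le_rfl h2,
    ceval_eq_tensorHom x (y + y') (openKer x) N le_rfl h3, ← LinearMap.add_apply]
  congr 1
  refine tensor_hom_ext fun σ τ => ?_
  rw [LinearMap.add_apply, tensorHom_tmul, tensorHom_tmul, tensorHom_tmul, ← mul_add]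
  rfl

/-- An element of the completed tensor square as a biadditive form on characters. -/
def cevalHom (f : CTensor n A) : (A →ₜ+ ZMod n) →+ (A →ₜ+ ZMod n) →+ ZMod n :=
  AddMonoidHom.mk' (fun x => AddMonoidHom.mk' (fun y => ceval x y f)
    fun y y' => ceval_add_right x y y' f) fun x x' => by
      ext y
      exact ceval_add_left x x' y f

theorem finite_notMem_of_tendsto {I : Type*} {b : I → A} (hb : Tendsto b cofinite (𝓝 0))
    (N : OpenSub n A) : {i | b i ∉ N.1}.Finite :=
  hb.eventually (N.2.mem_nhds N.1.zero_mem)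

theorem finite_tensor_support {I : Type*} {b : I → A} (hb : Tendsto b cofinite (𝓝 0))
    (c : I × I → ZMod n) (N₁ N₂ : OpenSub n A) :
    (Function.support fun p : I × I =>
      c p • (N₁.1.mkQ (b p.1) ⊗ₜ[ZMod n] N₂.1.mkQ (b p.2))).Finite := by
  refine ((finite_notMem_of_tendsto hb N₁).prod (finite_notMem_of_tendsto hb N₂)).subset ?_
  rintro ⟨i, j⟩ hij
  refine ⟨fun h => hij ?_, fun h => hij ?_⟩
  · have : N₁.1.mkQ (b i) = 0 := (Submodule.Quotient.mk_eq_zero _).2 h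
    simp only [this, TensorProduct.zero_tmul, smul_zero]
  · have : N₂.1.mkQ (b j) = 0 := (Submodule.Quotient.mk_eq_zero _).2 h
    simp only [this, TensorProduct.tmul_zero, smul_zero]

/-- The element `∑ c (i, j) bᵢ ⊗ bⱼ` of the completed tensor square, for a family `b` tending
to zero. -/
def ctensorSum {I : Type*} {b : I → A} (hb : Tendsto b cofinite (𝓝 0)) (c : I × I → ZMod n) :
    CTensor n A :=
  ⟨fun P => ∑ᶠ p : I × I, c p • (P.1.1.mkQ (b p.1) ⊗ₜ[ZMod n] P.2.1.mkQ (b p.2)),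
    fun P Q h₁ h₂ => by
      change (TensorProduct.map (Submodule.factor h₁) (Submodule.factor h₂)).toAddMonoidHom _ = _
      rw [AddMonoidHom.map_finsum _ (finite_tensor_support hb c P.1 P.2)]
      refine finsum_congr fun p => ?_
      rw [LinearMap.toAddMonoidHom_coe, map_smul, TensorProduct.map_tmul]
      rfl⟩

theorem ceval_ctensorSum {I : Type*} {b : I → A} (hb : Tendsto b cofinite (𝓝 0))
    (c : I × I → ZMod n) (x y : A →ₜ+ ZMod n) :
    ceval x y (ctensorSum hb c) = ∑ᶠ p : I × I, c p * (x (b p.1) * y (b p.2)) := by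
  change (tensorHom x y (openKer x) (openKer y) le_rfl le_rfl).toAddMonoidHom
    (∑ᶠ p : I × I, c p • ((openKer x).1.mkQ (b p.1) ⊗ₜ[ZMod n] (openKer y).1.mkQ (b p.2))) = _
  rw [AddMonoidHom.map_finsum _ (finite_tensor_support hb c (openKer x) (openKer y))]
  refine finsum_congr fun p => ?_
  rw [LinearMap.toAddMonoidHom_coe, map_smul, tensorHom_tmul, smul_eq_mul]

end CompletedTensor

/-! ### The pairing of `Sfr` with H². -/

section Pairing

variable {n : ℕ} [NeZero n] {G : Type*} [Group G] [TopologicalSpace G] [IsTopologicalGroup G]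
  [CompactSpace G] {I : Type*} (e : G1 n G ≃ₜ* Multiplicative (I → ZMod n))

theorem totallyDisconnectedSpace_G1 {n : ℕ} {G : Type*} [Group G] [TopologicalSpace G]
    [IsTopologicalGroup G] {I : Type*} (e : G1 n G ≃ₜ* Multiplicative (I → ZMod n)) :
    TotallyDisconnectedSpace (G1 n G) :=
  (e.toHomeomorph.trans
    (Homeomorph.refl _ : Multiplicative (I → ZMod n) ≃ₜ (I → ZMod n))).symm.totallyDisconnectedSpace

theorem IsPairing.unique (e : G1 n G ≃ₜ* Multiplicative (I → ZMod n))
    {P Q : Sfr n G →+ H2 n (G1 n G) →+ ZMod n} (hP : IsPairing P) (hQ : IsPairing Q) : P = Q := by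
  have := totallyDisconnectedSpace_G1 e
  ext1 s
  refine H2_hom_ext e (fun i j => ?_) fun i => ?_
  · rw [hP.1, hQ.1]
  · rw [hP.2, hQ.2]

/-- The condition defining `Sfr` is exactly the compatibility that `exists_H2_hom` asks of a pair of
forms. Additivity in s follows because generators determine a homomorphism on H². -/
theorem exists_isPairing (e : G1 n G ≃ₜ* Multiplicative (I → ZMod n)) :
    ∃ P : Sfr n G →+ H2 n (G1 n G) →+ ZMod n, IsPairing P := by
  have := totallyDisconnectedSpace_G1 e
  have h : ∀ s : Sfr n G, ∃ θ : H2 n (G1 n G) →+ ZMod n,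
      (∀ x y, θ (cup x y) = ceval x y s.1.1) ∧ ∀ z : H1 n (G1 n G), θ (bockstein z) = z s.1.2 :=
    fun s => exists_H2_hom e (cevalHom s.1.1)
      (AddMonoidHom.mk' (fun z : H1 n (G1 n G) => z s.1.2) fun _ _ => rfl) s.2
  choose P hP1 hP2 using h
  refine ⟨AddMonoidHom.mk' P fun s t => H2_hom_ext e (fun i j => ?_) fun i => ?_, hP1, hP2⟩
  · rw [AddMonoidHom.add_apply, hP1, hP1, hP1]
    exact map_add (ceval _ _) _ _
  · rw [AddMonoidHom.add_apply, hP2, hP2, hP2]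
    exact map_add _ _ _

theorem isPairing_pairing (e : G1 n G ≃ₜ* Multiplicative (I → ZMod n)) :
    IsPairing (pairing n G) := by
  have h := exists_isPairing e
  rw [pairing, dif_pos h]
  exact h.choose_spec

/-- Both sides agree on cup products and Bocksteins. Since `transgress_bracket` yields the same
form, this fixes the value of Ω at commutators; `pairing_sPow` does it for powers. -/
theorem pairing_sBracket (e : G1 n G ≃ₜ* Multiplicative (I → ZMod n)) (σ τ : A1 n G) :
    pairing n G (sBracket σ τ) = commForm σ.toMul τ.toMul := by
  have := totallyDisconnectedSpace_G1 e
  have hP := isPairing_pairing e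
  refine H2_hom_ext e (fun i j => ?_) fun i => ?_
  · rw [hP.1, commForm_cup]
    simp only [sBracket, map_sub, ceval_ctmul]
    simp
  · rw [hP.2, commForm_bockstein]
    exact map_zero _

theorem pairing_sPow (e : G1 n G ≃ₜ* Multiplicative (I → ZMod n)) (σ : A1 n G) :
    pairing n G (sPow σ) = powForm (G1_pow n G) σ.toMul := by
  have := totallyDisconnectedSpace_G1 e
  have hP := isPairing_pairing e
  refine H2_hom_ext e (fun i j => ?_) fun i => ?_
  · rw [hP.1, powForm_cup]
    simp only [sPow, map_nsmul, ceval_ctmul, nsmul_eq_mul]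
    rfl
  · rw [hP.2, powForm_bockstein]
    rfl

/-- The pairing identifies `Sfr` with the dual of `H²`: surjectivity. -/
theorem exists_pairing_eq (e : G1 n G ≃ₜ* Multiplicative (I → ZMod n))
    (θ : H2 n (G1 n G) →+ ZMod n) : ∃ s : Sfr n G, pairing n G s = θ := by
  classical
  have := totallyDisconnectedSpace_G1 e
  have hP := isPairing_pairing e
  let b : I → A1 n G := fun i => Additive.ofMul (basisElt e i)
  have hb : Filter.Tendsto b Filter.cofinite (nhds 0) := tendsto_basisElt e
  -- The coefficients of f and the coordinates of g are the values of θ on the generators. The pair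
  -- (f, g) lies in `Sfr` because of `cup_self`.
  let f : CTensor n (A1 n G) :=
    ctensorSum hb fun p => θ (cup (coordHom e p.1) (coordHom e p.2))
  let g : A1 n G := Additive.ofMul (e.symm (Multiplicative.ofAdd fun i =>
    θ (bockstein (coordHom e i))))
  have hf : ∀ x y : H1 n (G1 n G), ceval x y f = θ (cup x y) := by
    have : cevalHom f = cupHom.compr₂ θ := by
      refine H1_hom_ext e fun i => H1_hom_ext e fun j => ?_
      change ceval (coordHom e i) (coordHom e j) f = θ (cup (coordHom e i) (coordHom e j))
      rw [ceval_ctensorSum, finsum_eq_single _ (i, j)]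
      · simp [b, coordHom_basisElt]
      · rintro ⟨k, l⟩ hne
        simp only [b, coordHom_basisElt]
        by_cases h1 : i = k
        · have h2 : ¬ j = l := fun h2 => hne (by rw [h1, h2])
          simp [h2]
        · simp [h1]
    intro x y
    exact DFunLike.congr_fun (DFunLike.congr_fun this x) y
  have hg : ∀ z : H1 n (G1 n G), z g = θ (bockstein z) := by
    have : (AddMonoidHom.mk' (fun z : H1 n (G1 n G) => z g) fun _ _ => rfl)
        = θ.comp (bocksteinHom e) :=
      H1_hom_ext e fun i => coordHom_ofAdd_symm e i _
    intro z
    exact DFunLike.congr_fun this z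
  refine ⟨⟨(f, g), fun x => ?_⟩, H2_hom_ext e (fun i j => ?_) fun i => ?_⟩
  · rw [hf, hg, cup_self e, map_nsmul, nsmul_eq_mul]
  · rw [hP.1, hf]
  · rw [hP.2, hg]

end Pairing

/-! ### The second graded piece: topological generators and characters. -/

section SecondPiece

variable {n : ℕ} {G : Type*} [Group G] [TopologicalSpace G] [IsTopologicalGroup G]

theorem mk2_surjective : Function.Surjective (mk2 : centralSeries n G 2 → A2 n G) := fun a =>
  QuotientGroup.mk_surjective a.toMul

theorem mk1_surjective : Function.Surjective (mk1 : G → A1 n G) := fun a =>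
  QuotientGroup.mk_surjective a.toMul

theorem mk2_mul (a b : centralSeries n G 2) : mk2 (a * b) = mk2 a + mk2 b := rfl

theorem mk2_eq_iff {a b : centralSeries n G 2} :
    mk2 a = mk2 b ↔ (a : G)⁻¹ * b ∈ centralSeries n G 3 := by
  change (QuotientGroup.mk a : G2 n G) = QuotientGroup.mk b ↔ _
  rw [QuotientGroup.eq, Subgroup.mem_subgroupOf]
  rfl

theorem bracket_mk1 (a b : G) :
    bracket (mk1 a : A1 n G) (mk1 b) = mk2 ⟨a⁻¹ * b⁻¹ * a * b, comm_mem_two a b⟩ := rfl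

theorem powPi_mk1 (a : G) : powPi (mk1 a : A1 n G) = mk2 ⟨a ^ n, pow_mem_two a⟩ := rfl

theorem A2_nsmul_eq_zero (a : A2 n G) : n • a = 0 := by
  obtain ⟨δ, rfl⟩ := mk2_surjective a
  have h1 : n • mk2 δ = mk2 (δ ^ n) := rfl
  have h2 : (0 : A2 n G) = mk2 1 := rfl
  rw [h1, h2, eq_comm, mk2_eq_iff]
  simpa using pow_mem_succ (n := n) (i := 2) (by norm_num) δ.2

theorem continuous_A2_iff {X : Type*} [TopologicalSpace X] {f : A2 n G → X} :
    Continuous f ↔ Continuous fun δ : centralSeries n G 2 => f (mk2 δ) :=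
  isQuotientMap_quot_mk.continuous_iff

theorem isClosed_centralSeries_two : IsClosed (centralSeries n G 2 : Set G) :=
  Subgroup.isClosed_topologicalClosure _

theorem isClosed_centralSeries_three : IsClosed (centralSeries n G 3 : Set G) :=
  Subgroup.isClosed_topologicalClosure _

/-- The second graded piece is topologically generated by commutators and `n`-th powers. -/
theorem A2_hom_ext {X : Type*} [AddCommGroup X] [TopologicalSpace X] [T2Space X]
    {χ χ' : A2 n G →+ X} (hχ : Continuous χ) (hχ' : Continuous χ')
    (hb : ∀ σ τ, χ (bracket σ τ) = χ' (bracket σ τ)) (hp : ∀ σ, χ (powPi σ) = χ' (powPi σ)) :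
    χ = χ' := by
  let K : Subgroup (centralSeries n G 2) :=
    { carrier := {δ | χ (mk2 δ) = χ' (mk2 δ)}
      one_mem' := by
        change χ 0 = χ' 0
        rw [map_zero, map_zero]
      mul_mem' := by
        intro a b ha hb
        simp only [Set.mem_ofPred_eq, mk2_mul, map_add] at *
        rw [ha, hb]
      inv_mem' := by
        intro a ha
        change χ (-mk2 a) = χ' (-mk2 a)
        rw [map_neg, map_neg, ha] }
  have hK : IsClosed (K : Set (centralSeries n G 2)) :=
    isClosed_eq (continuous_A2_iff.1 hχ) (continuous_A2_iff.1 hχ')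
  -- K is closed in G⁽²⁾, which is closed in G. Hence it suffices that K contains the generators of
  -- which G⁽²⁾ is the closure.
  have hcl : IsClosed ((K.map (centralSeries n G 2).subtype : Subgroup G) : Set G) :=
    isClosed_centralSeries_two.isClosedEmbedding_subtypeVal.isClosedMap _ hK
  have hle : centralSeries n G 2 ≤ K.map (centralSeries n G 2).subtype := by
    refine Subgroup.topologicalClosure_minimal _ (sup_le ?_ ?_) hcl
    · rw [Subgroup.commutator_le]
      intro a _ b _
      -- The inverses convert a b a⁻¹ b⁻¹, the commutator that defines the series, into the
      -- convention of `bracket`.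
      refine ⟨⟨a⁻¹⁻¹ * b⁻¹⁻¹ * a⁻¹ * b⁻¹, comm_mem_two _ _⟩, ?_, ?_⟩
      · exact hb (mk1 a⁻¹) (mk1 b⁻¹)
      · simp [commutatorElement_def]
    · rw [Subgroup.closure_le]
      rintro _ ⟨a, -, rfl⟩
      exact ⟨⟨a ^ n, pow_mem_two a⟩, hp (mk1 a), rfl⟩
  refine DFunLike.ext _ _ fun a => ?_
  obtain ⟨δ, rfl⟩ := mk2_surjective a
  obtain ⟨δ', h, h'⟩ := hle δ.2
  have : δ' = δ := Subtype.ext h'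
  exact this ▸ h

theorem map2_bracket {H : Type*} [Group H] [TopologicalSpace H] [IsTopologicalGroup H]
    (f : G →ₜ* H) (σ τ : A1 n G) :
    map2 n f (bracket σ τ) = bracket (map1Add n f σ) (map1Add n f τ) := by
  obtain ⟨a, rfl⟩ := mk1_surjective σ
  obtain ⟨b, rfl⟩ := mk1_surjective τ
  change mk2 _ = mk2 _
  congr 1
  refine Subtype.ext ?_
  change f (a⁻¹ * b⁻¹ * a * b) = (f a)⁻¹ * (f b)⁻¹ * f a * f b
  simp

theorem map2_powPi {H : Type*} [Group H] [TopologicalSpace H] [IsTopologicalGroup H]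
    (f : G →ₜ* H) (σ : A1 n G) : map2 n f (powPi σ) = powPi (map1Add n f σ) := by
  obtain ⟨a, rfl⟩ := mk1_surjective σ
  change mk2 _ = mk2 _
  congr 1
  refine Subtype.ext ?_
  change f (a ^ n) = f a ^ n
  simp

theorem continuous_map2 {H : Type*} [Group H] [TopologicalSpace H] [IsTopologicalGroup H]
    (f : G →ₜ* H) : Continuous (map2 n f) := by
  rw [continuous_A2_iff]
  have h1 : Continuous (mk2 : centralSeries n H 2 → A2 n H) := continuous_A2_iff.1 continuous_id
  have h2 : Continuous (restrict2 n f) :=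
    Continuous.subtype_mk (f.continuous_toFun.comp continuous_subtype_val) _
  exact h1.comp h2

theorem isOpen_mul_left_mem {U : Subgroup G} (hU : IsOpen (U : Set G)) (a : G) :
    {b | a⁻¹ * b ∈ U} ∈ nhds a := by
  refine (hU.preimage (continuous_const_mul a⁻¹)).mem_nhds ?_
  simp

/-- Continuous characters separate the points of the second graded piece. -/
theorem exists_character_A2 [NeZero n] [CompactSpace G] [TotallyDisconnectedSpace G] {a : A2 n G}
    (ha : a ≠ 0) : ∃ χ : A2 n G →+ ZMod n, Continuous χ ∧ χ a ≠ 0 := by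
  obtain ⟨δ, rfl⟩ := mk2_surjective a
  have hδ : (δ : G) ∉ centralSeries n G 3 := fun h => ha (by
    have : (0 : A2 n G) = mk2 1 := rfl
    rw [this, eq_comm, mk2_eq_iff]
    simpa using h)
  -- G⁽³⁾ is closed, so some translate δU misses it. The image B of U ∩ G⁽²⁾ in `A2` then omits the
  -- class of δ, and a character trivial on B is continuous.
  obtain ⟨U, hU⟩ := ProfiniteGrp.exist_openNormalSubgroup_sub_open_nhds_of_one
    (U := {u : G | (δ : G) * u ∉ centralSeries n G 3})
    (isClosed_centralSeries_three.isOpen_compl.preimage (continuous_const_mul (δ : G)))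
    (by simpa using hδ)
  let B : AddSubgroup (A2 n G) :=
    { carrier := {b | ∃ u : centralSeries n G 2, (u : G) ∈ U ∧ mk2 u = b}
      zero_mem' := ⟨1, one_mem U, rfl⟩
      add_mem' := by
        rintro _ _ ⟨u, hu, rfl⟩ ⟨v, hv, rfl⟩
        exact ⟨u * v, mul_mem hu hv, rfl⟩
      neg_mem' := by
        rintro _ ⟨u, hu, rfl⟩
        exact ⟨u⁻¹, inv_mem hu, rfl⟩ }
  have hB : (QuotientAddGroup.mk (mk2 δ) : A2 n G ⧸ B) ≠ 0 := by
    intro h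
    obtain ⟨u, hu, hu'⟩ := (QuotientAddGroup.eq_zero_iff _).1 h
    rw [mk2_eq_iff] at hu'
    have h1 := (centralSeries_normal n G 3).conj_mem _ hu' u
    rw [mul_inv_cancel_left] at h1
    exact hU (inv_mem hu) h1
  obtain ⟨c, hc⟩ := exists_hom_zmod_ne_zero (n := n) (A := A2 n G ⧸ B) (by
    intro b
    induction b using QuotientAddGroup.induction_on with | H b => ?_
    rw [← QuotientAddGroup.mk_nsmul, A2_nsmul_eq_zero, QuotientAddGroup.mk_zero]) hB
  refine ⟨c.comp (QuotientAddGroup.mk' B), ?_, hc⟩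
  rw [continuous_A2_iff]
  refine (IsLocallyConstant.iff_eventually_eq _).2 (fun x => ?_) |>.continuous
  have h1 := continuous_subtype_val.continuousAt.preimage_mem_nhds
    (isOpen_mul_left_mem (U := U.toSubgroup) U.isOpen' (x : G))
  filter_upwards [h1] with y hy
  change c (QuotientAddGroup.mk (mk2 y)) = c (QuotientAddGroup.mk (mk2 x))
  congr 1
  rw [eq_comm, QuotientAddGroup.eq]
  exact ⟨x⁻¹ * y, hy, rfl⟩

end SecondPiece

/-! ### The kernel of inflation as the character group of the second graded piece. -/

section Transgression

variable {n : ℕ} {G : Type*} [Group G] [TopologicalSpace G] [IsTopologicalGroup G]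

variable (n G) in
/-- Pairs of a 2-cocycle on the first graded piece and a cochain bounding its inflation. -/
def BoundedCocycles : AddSubgroup (Z2 n (G1 n G) × C(G, ZMod n)) where
  carrier := {t | ∀ a b : G, t.1.1 (QuotientGroup.mk a, QuotientGroup.mk b)
    = t.2 b - t.2 (a * b) + t.2 a}
  zero_mem' a b := by simp
  add_mem' {s t} hs ht a b := by
    have h1 := hs a b
    have h2 := ht a b
    simp only [Prod.fst_add, Prod.snd_add, AddSubgroup.coe_add, ContinuousMap.add_apply, h1, h2]
    ring
  neg_mem' {s} hs a b := by
    have h1 := hs a b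
    simp only [Prod.fst_neg, Prod.snd_neg, AddSubgroup.coe_neg, ContinuousMap.neg_apply, h1]
    ring

variable (n G) in
/-- The class in `H²` of a bounded cocycle. -/
def boundedClass : BoundedCocycles n G →+ H2 n (G1 n G) :=
  (QuotientAddGroup.mk' _).comp ((AddMonoidHom.fst _ _).comp (BoundedCocycles n G).subtype)

theorem boundedClass_apply (t : BoundedCocycles n G) :
    boundedClass n G t = QuotientAddGroup.mk t.1.1 := rfl

theorem range_boundedClass : (boundedClass n G).range = (inf2 n G).ker := by
  ext h
  induction h using QuotientAddGroup.induction_on with | H ξ => ?_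
  rw [AddMonoidHom.mem_ker]
  change _ ↔ (QuotientAddGroup.mk (Z2map n (proj1 n G) ξ) : H2 n G) = 0
  rw [QuotientAddGroup.eq_zero_iff]
  constructor
  · rintro ⟨t, ht⟩
    obtain ⟨w, hw⟩ := QuotientAddGroup.eq.1 ht
    -- Changing the representative by the coboundary of w changes the bounding cochain by the
    -- inflation of w.
    refine ⟨t.1.2 + w.comp ⟨proj1 n G, (proj1 n G).continuous_toFun⟩, ContinuousMap.ext fun p => ?_⟩
    have h1 := t.2 p.1 p.2
    have h2 := DFunLike.congr_fun hw
      ((QuotientGroup.mk p.1, QuotientGroup.mk p.2) : G1 n G × G1 n G)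
    change w (QuotientGroup.mk p.2) - w (QuotientGroup.mk (p.1 * p.2)) + w (QuotientGroup.mk p.1)
      = -t.1.1.1 (QuotientGroup.mk p.1, QuotientGroup.mk p.2)
        + ξ.1 (QuotientGroup.mk p.1, QuotientGroup.mk p.2) at h2
    change (t.1.2 p.2 + w (QuotientGroup.mk p.2)) - (t.1.2 (p.1 * p.2)
      + w (QuotientGroup.mk (p.1 * p.2))) + (t.1.2 p.1 + w (QuotientGroup.mk p.1))
      = ξ.1 (QuotientGroup.mk p.1, QuotientGroup.mk p.2)
    linear_combination h2 - h1
  · rintro ⟨u, hu⟩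
    exact ⟨⟨(ξ, u), fun a b => (DFunLike.congr_fun hu (a, b)).symm⟩, rfl⟩

theorem bounded_one (t : BoundedCocycles n G) : t.1.1.1 (1, 1) = t.1.2 1 := by
  have := t.2 1 1
  rw [QuotientGroup.mk_one, one_mul] at this
  rw [this]
  ring

theorem bounded_mul (t : BoundedCocycles n G) (a b : G) :
    t.1.2 (a * b) = t.1.2 a + t.1.2 b - t.1.1.1 (QuotientGroup.mk a, QuotientGroup.mk b) := by
  rw [t.2 a b]
  ring

theorem bounded_mul_right (t : BoundedCocycles n G) (a : G) {δ : G}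
    (hδ : δ ∈ centralSeries n G 2) : t.1.2 (a * δ) = t.1.2 a + t.1.2 δ - t.1.2 1 := by
  rw [bounded_mul, (QuotientGroup.eq_one_iff δ).2 hδ, Z2_apply_one_right, bounded_one]

theorem bounded_mul_left (t : BoundedCocycles n G) (a : G) {δ : G}
    (hδ : δ ∈ centralSeries n G 2) : t.1.2 (δ * a) = t.1.2 δ + t.1.2 a - t.1.2 1 := by
  rw [bounded_mul, (QuotientGroup.eq_one_iff δ).2 hδ, Z2_apply_one_left, bounded_one]

/-- The restriction to `G⁽²⁾` of a bounding cochain, normalized, as a homomorphism. -/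
def boundedRestrict (t : BoundedCocycles n G) : centralSeries n G 2 →* Multiplicative (ZMod n) where
  -- The sign is chosen so that commutators give ξ(σ, τ) - ξ(τ, σ) rather than its negative.
  toFun δ := Multiplicative.ofAdd (t.1.2 1 - t.1.2 δ)
  map_one' := by simp
  map_mul' a b := by
    rw [← ofAdd_add, Subgroup.coe_mul, bounded_mul_right t a b.2]
    congr 1
    ring

/-- The cochain takes the same value at b ∈ G⁽²⁾ and at its conjugates, which disposes of the
commutators. The n-th powers die in ℤ/n, and continuity covers the closure. -/
theorem boundedRestrict_eq_one (t : BoundedCocycles n G) {δ : centralSeries n G 2}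
    (hδ : (δ : G) ∈ centralSeries n G 3) : boundedRestrict t δ = 1 := by
  have hcl : IsClosed (((boundedRestrict t).ker.map (centralSeries n G 2).subtype : Subgroup G) :
      Set G) := by
    refine isClosed_centralSeries_two.isClosedEmbedding_subtypeVal.isClosedMap _ ?_
    have : Continuous fun δ : centralSeries n G 2 => t.1.2 1 - t.1.2 δ := by fun_prop
    exact (isClosed_discrete ({0} : Set (ZMod n))).preimage this
  have hle : centralSeries n G 3 ≤ (boundedRestrict t).ker.map (centralSeries n G 2).subtype := by
    refine Subgroup.topologicalClosure_minimal _ (sup_le ?_ ?_) hcl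
    · rw [Subgroup.commutator_le]
      intro a _ b hb
      have hb' := (centralSeries_normal n G 2).conj_mem b hb a
      refine ⟨⟨a * b * a⁻¹ * b⁻¹, ?_⟩, ?_, rfl⟩
      · exact mul_mem hb' (inv_mem hb)
      · have h1 : (⟨a * b * a⁻¹ * b⁻¹, mul_mem hb' (inv_mem hb)⟩ : centralSeries n G 2)
            = ⟨a * b * a⁻¹, hb'⟩ * ⟨b, hb⟩⁻¹ := rfl
        have h2 := bounded_mul_left t a hb'
        rw [inv_mul_cancel_right, bounded_mul_right t a hb] at h2
        have h3 : t.1.2 (a * b * a⁻¹) = t.1.2 b := by linear_combination -h2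
        have h4 : boundedRestrict t ⟨a * b * a⁻¹, hb'⟩ = boundedRestrict t ⟨b, hb⟩ := by
          change Multiplicative.ofAdd (t.1.2 1 - t.1.2 (a * b * a⁻¹)) =
            Multiplicative.ofAdd (t.1.2 1 - t.1.2 b)
          rw [h3]
        exact MonoidHom.mem_ker.2 (by rw [h1, map_mul, map_inv, h4, mul_inv_cancel])
    · rw [Subgroup.closure_le]
      rintro _ ⟨a, ha, rfl⟩
      refine ⟨⟨a, ha⟩ ^ n, ?_, rfl⟩
      refine MonoidHom.mem_ker.2 ?_
      rw [map_pow]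
      apply Multiplicative.toAdd.injective
      simp
  obtain ⟨δ', h, h'⟩ := hle hδ
  have : δ' = δ := Subtype.ext h'
  exact this ▸ h

/-- The inverse of the transgression, on the level of bounded cocycles. -/
def transgress : BoundedCocycles n G →+ A2 n G →+ ZMod n :=
  AddMonoidHom.mk' (fun t => MonoidHom.toAdditiveLeft (QuotientGroup.lift _ (boundedRestrict t)
    fun _ hδ => boundedRestrict_eq_one t (Subgroup.mem_subgroupOf.1 hδ))) fun s t => by
    refine DFunLike.ext _ _ fun a => ?_
    obtain ⟨δ, rfl⟩ := mk2_surjective a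
    change (s.1.2 1 + t.1.2 1) - (s.1.2 δ + t.1.2 δ) = (s.1.2 1 - s.1.2 δ) + (t.1.2 1 - t.1.2 δ)
    ring

theorem transgress_mk2 (t : BoundedCocycles n G) (δ : centralSeries n G 2) :
    transgress t (mk2 δ) = t.1.2 1 - t.1.2 δ := rfl

theorem continuous_transgress (t : BoundedCocycles n G) : Continuous (transgress t) := by
  rw [continuous_A2_iff]
  simp only [transgress_mk2]
  fun_prop

/-- The bounding cochain is evaluated at ab = ba · [a, b] in two ways. -/
theorem transgress_bracket (t : BoundedCocycles n G) (σ τ : A1 n G) :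
    transgress t (bracket σ τ) = commForm σ.toMul τ.toMul (boundedClass n G t) := by
  obtain ⟨a, rfl⟩ := mk1_surjective σ
  obtain ⟨b, rfl⟩ := mk1_surjective τ
  rw [bracket_mk1, transgress_mk2, boundedClass_apply, commForm_mk]
  change t.1.2 1 - t.1.2 (a⁻¹ * b⁻¹ * a * b) =
    t.1.1.1 (QuotientGroup.mk a, QuotientGroup.mk b)
      - t.1.1.1 (QuotientGroup.mk b, QuotientGroup.mk a)
  have h1 := bounded_mul_right t (b * a) (comm_mem_two (n := n) a b)
  have h2 : b * a * (a⁻¹ * b⁻¹ * a * b) = a * b := by group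
  rw [h2, bounded_mul, bounded_mul] at h1
  linear_combination h1

theorem transgress_powPi (t : BoundedCocycles n G) (σ : A1 n G) :
    transgress t (powPi σ) = powForm (G1_pow n G) σ.toMul (boundedClass n G t) := by
  obtain ⟨a, rfl⟩ := mk1_surjective σ
  rw [powPi_mk1, transgress_mk2, boundedClass_apply, powForm_mk]
  have h : ∀ m : ℕ, t.1.2 1 - t.1.2 (a ^ m) + m * t.1.2 a =
      ∑ k ∈ Finset.range m, t.1.1.1 (QuotientGroup.mk a ^ k, QuotientGroup.mk a) := by
    intro m
    induction m with
    | zero => simp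
    | succ m ih =>
      rw [Finset.sum_range_succ, ← ih, pow_succ, bounded_mul, QuotientGroup.mk_pow]
      push_cast
      ring
  have := h n
  rw [ZMod.natCast_self, zero_mul, add_zero] at this
  exact this

theorem transgress_eq_zero_of_class (t : BoundedCocycles n G) (ht : boundedClass n G t = 0) :
    transgress t = 0 := by
  refine A2_hom_ext (continuous_transgress t) continuous_const (fun σ τ => ?_) fun σ => ?_
  · rw [transgress_bracket, ht, map_zero]
    rfl
  · rw [transgress_powPi, ht, map_zero]
    rfl

/-- If the character is trivial, the bounding cochain is constant on cosets of G⁽²⁾. It descends to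
`G1` and bounds the cocycle there. -/
theorem class_eq_zero_of_transgress (t : BoundedCocycles n G) (ht : transgress t = 0) :
    boundedClass n G t = 0 := by
  have h1 : ∀ δ ∈ centralSeries n G 2, t.1.2 δ = t.1.2 1 := fun δ hδ => by
    have := DFunLike.congr_fun ht (mk2 ⟨δ, hδ⟩)
    rw [transgress_mk2, AddMonoidHom.zero_apply, sub_eq_zero] at this
    exact this.symm
  let w : G1 n G → ZMod n := Quotient.lift (fun a => t.1.2 a) fun a b hab => by
    have h2 := bounded_mul_right t a (QuotientGroup.leftRel_apply.1 hab)
    rw [mul_inv_cancel_left, h1 _ (QuotientGroup.leftRel_apply.1 hab)] at h2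
    rw [h2]
    ring
  have hw : Continuous w := continuous_quot_lift _ t.1.2.continuous
  refine (H2_mk_eq_zero_iff _).2 ⟨⟨w, hw⟩, fun x y => ?_⟩
  obtain ⟨a, rfl⟩ := QuotientGroup.mk_surjective x
  obtain ⟨b, rfl⟩ := QuotientGroup.mk_surjective y
  exact t.2 a b

/-- A continuous homomorphism on a closed normal subgroup of a profinite group is the restriction
of a continuous equivariant function. -/
theorem exists_equivariant_extension [CompactSpace G] [TotallyDisconnectedSpace G]
    {N : Subgroup G} [N.Normal] {X : Type*} [AddGroup X] [TopologicalSpace X]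
    [DiscreteTopology X] (χ : N → X) (hχ : Continuous χ)
    (hmul : ∀ a b, χ (a * b) = χ a + χ b) :
    ∃ u : C(G, X), ∀ (a : G) (δ : N), u (a * δ) = u a + χ δ := by
  have h1 : χ 1 = 0 := by
    have := hmul 1 1
    rw [mul_one] at this
    exact left_eq_add.1 this
  obtain ⟨W, hWo, hW⟩ := isOpen_induced_iff.1 ((isOpen_discrete ({0} : Set X)).preimage hχ)
  have h1W : (1 : G) ∈ W := by
    have : (1 : N) ∈ Subtype.val ⁻¹' W := by
      rw [hW]
      exact h1
    exact this
  obtain ⟨U, hUo, hUn, hU⟩ : ∃ U : Subgroup G, IsOpen (U : Set G) ∧ U.Normal ∧ (U : Set G) ⊆ W := by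
    obtain ⟨U, hU⟩ := ProfiniteGrp.exist_openNormalSubgroup_sub_open_nhds_of_one hWo h1W
    exact ⟨U.toSubgroup, U.isOpen', U.isNormal', hU⟩
  have hUχ : ∀ δ : N, (δ : G) ∈ U → χ δ = 0 := fun δ hδ => by
    have : δ ∈ Subtype.val ⁻¹' W := hU hδ
    rw [hW] at this
    exact this
  -- With r(a) a fixed representative of aS, the extension is χ(δ) for any δ ∈ N congruent to r(a)⁻¹
  -- a modulo U. The choice of δ is immaterial because χ is trivial on U ∩ N.
  let S : Subgroup G := U ⊔ N
  let r : G → G := fun a => (QuotientGroup.mk a : G ⧸ S).out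
  have hr : ∀ a, (r a)⁻¹ * a ∈ S := fun a => QuotientGroup.eq.1 (QuotientGroup.out_eq' _)
  have hr' : ∀ a, ∀ s ∈ S, r (a * s) = r a := fun a s hs => by
    have : (QuotientGroup.mk (a * s) : G ⧸ S) = QuotientGroup.mk a := by
      rw [eq_comm, QuotientGroup.eq]
      simpa using hs
    simp only [r, this]
  have hex : ∀ a, ∃ δ : N, ((r a)⁻¹ * a)⁻¹ * δ ∈ U := fun a => by
    obtain ⟨v, hv, δ, hδ, hvδ⟩ := Subgroup.mem_sup_of_normal_right.1 (hr a)
    refine ⟨⟨δ, hδ⟩, ?_⟩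
    rw [← hvδ]
    have := hUn.conj_mem _ (inv_mem hv) δ⁻¹
    simpa [mul_assoc] using this
  choose d hd using hex
  have huniq : ∀ a (δ : N), ((r a)⁻¹ * a)⁻¹ * δ ∈ U → χ (d a) = χ δ := by
    intro a δ hδ
    have h2 := mul_mem (inv_mem (hd a)) hδ
    have h3 : ((d a)⁻¹ * δ : N) ∈ U.subgroupOf N := by
      rw [Subgroup.mem_subgroupOf]
      simpa [mul_assoc] using h2
    have h4 := hmul (d a) ((d a)⁻¹ * δ)
    rw [mul_inv_cancel_left, hUχ _ (Subgroup.mem_subgroupOf.1 h3), add_zero] at h4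
    exact h4.symm
  have hcont : Continuous fun a => χ (d a) := by
    refine (IsLocallyConstant.iff_eventually_eq _).2 (fun a => ?_) |>.continuous
    filter_upwards [isOpen_mul_left_mem hUo a] with b hb
    refine huniq b (d a) ?_
    have h2 : r b = r a := by
      have := hr' a _ (Subgroup.mem_sup_left hb : a⁻¹ * b ∈ S)
      rwa [mul_inv_cancel_left] at this
    rw [h2]
    have h3 := mul_mem (inv_mem hb) (hd a)
    simpa [mul_assoc] using h3
  refine ⟨⟨_, hcont⟩, fun a δ => ?_⟩
  change χ (d (a * δ)) = χ (d a) + χ δ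
  rw [← hmul]
  refine huniq _ _ ?_
  rw [hr' a _ (Subgroup.mem_sup_right δ.2)]
  have h2 := hUn.conj_mem _ (hd a) (δ : G)⁻¹
  simpa [mul_assoc] using h2

/-- Every continuous character of the second graded piece is the restriction of a cochain that
bounds the inflation of a 2-cocycle. -/
theorem exists_transgress_eq [CompactSpace G] [TotallyDisconnectedSpace G] (χ : A2 n G →+ ZMod n)
    (hχ : Continuous χ) : ∃ t : BoundedCocycles n G, transgress t = χ := by
  obtain ⟨u, hu⟩ := exists_equivariant_extension (N := centralSeries n G 2)
    (fun δ => -χ (mk2 δ)) (continuous_A2_iff.1 hχ).neg fun a b => by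
      rw [mk2_mul, map_add, neg_add]
  -- χ is invariant under conjugation, as [G, G⁽²⁾] ⊆ G⁽³⁾. With equivariance of u, this makes the
  -- coboundary of u depend only on cosets of G⁽²⁾, so it descends to a cocycle on `G1`.
  have hconj : ∀ (a : G) (δ : centralSeries n G 2),
      χ (mk2 ⟨a⁻¹ * δ * a, by
        simpa using (centralSeries_normal n G 2).conj_mem _ δ.2 a⁻¹⟩) = χ (mk2 δ) := by
    intro a δ
    congr 1
    rw [mk2_eq_iff]
    have := commutator_mem_succ (n := n) (i := 2) (by norm_num) a⁻¹ (inv_mem δ.2)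
    simpa [mul_assoc] using this
  let F : C(G × G, ZMod n) := ⟨fun p => u p.2 - u (p.1 * p.2) + u p.1, by fun_prop⟩
  have hq : Topology.IsQuotientMap (Prod.map QuotientGroup.mk QuotientGroup.mk :
      G × G → G1 n G × G1 n G) :=
    (QuotientGroup.isOpenQuotientMap_mk.prodMap QuotientGroup.isOpenQuotientMap_mk).isQuotientMap
  let q : C(G × G, G1 n G × G1 n G) := ⟨_, hq.continuous⟩
  have hF : ∀ p p' : G × G, q p = q p' → F p = F p' := by
    rintro ⟨a, b⟩ ⟨a', b'⟩ h
    have ha := QuotientGroup.eq.1 (congrArg Prod.fst h)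
    have hb := QuotientGroup.eq.1 (congrArg Prod.snd h)
    obtain ⟨δ, rfl⟩ : ∃ δ : centralSeries n G 2, a' = a * δ := ⟨⟨_, ha⟩, by simp⟩
    obtain ⟨ε, rfl⟩ : ∃ ε : centralSeries n G 2, b' = b * ε := ⟨⟨_, hb⟩, by simp⟩
    change u b - u (a * b) + u a = u (b * ε) - u (a * δ * (b * ε)) + u (a * δ)
    have h1 : a * δ * (b * ε) = a * b * ((⟨b⁻¹ * δ * b, by
        simpa using (centralSeries_normal n G 2).conj_mem _ δ.2 b⁻¹⟩ * ε :
        centralSeries n G 2) : G) := by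
      simp [mul_assoc]
    rw [h1, hu, hu, hu, mk2_mul, map_add, hconj]
    ring
  let ξ : C(G1 n G × G1 n G, ZMod n) := Topology.IsQuotientMap.lift (f := q) hq F hF
  have hξ : ∀ a b : G, ξ (QuotientGroup.mk a, QuotientGroup.mk b) = u b - u (a * b) + u a :=
    fun a b => DFunLike.congr_fun (Topology.IsQuotientMap.lift_comp (f := q) hq F hF) (a, b)
  refine ⟨⟨(⟨ξ, fun x y z => ?_⟩, u), hξ⟩, ?_⟩
  · obtain ⟨a, rfl⟩ := QuotientGroup.mk_surjective x
    obtain ⟨b, rfl⟩ := QuotientGroup.mk_surjective y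
    obtain ⟨c, rfl⟩ := QuotientGroup.mk_surjective z
    rw [← QuotientGroup.mk_mul, ← QuotientGroup.mk_mul, hξ, hξ, hξ, hξ, mul_assoc]
    ring
  · refine DFunLike.ext _ _ fun x => ?_
    obtain ⟨δ, rfl⟩ := mk2_surjective x
    rw [transgress_mk2]
    have := hu 1 δ
    rw [one_mul] at this
    change u 1 - u δ = _
    rw [this]
    ring

end Transgression

/-! ### Construction and uniqueness of Ω. -/

section Omega

variable {n : ℕ} {G : Type*} [Group G] [TopologicalSpace G] [IsTopologicalGroup G] {I : Type*}
  {R : Set (H2 n (G1 n G))}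

theorem compactSpace_A2 [CompactSpace G] : CompactSpace (A2 n G) := by
  have : CompactSpace (centralSeries n G 2) :=
    isCompact_iff_compactSpace.1 isClosed_centralSeries_two.isCompact
  have : CompactSpace (G2 n G) := inferInstance
  exact this

theorem exists_boundedClass_eq (hR : AddSubgroup.closure R = (inf2 n G).ker) (r : R) :
    ∃ t : BoundedCocycles n G, boundedClass n G t = r := by
  have h : (r : H2 n (G1 n G)) ∈ (boundedClass n G).range := by
    rw [range_boundedClass, ← hR]
    exact AddSubgroup.subset_closure r.2
  exact h

variable [NeZero n]

theorem pairing_boundedClass_eq_zero (s : Sfr n G) (t : BoundedCocycles n G)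
    (ht : transgress t = 0) : pairing n G s (boundedClass n G t) = 0 := by
  rw [class_eq_zero_of_transgress t ht]
  exact map_zero (pairing n G s)

theorem exists_pairing_eq_of_mem_SR {c : R → ZMod n} (hc : c ∈ SR R) :
    ∃ s : Sfr n G, ∀ r : R, c r = pairing n G s r := by
  obtain ⟨s, hs⟩ := hc
  exact ⟨s, fun r => (congrFun hs r).symm⟩

theorem IsOmega.unique {Ω Ω' : A2 n G ≃ₜ+ SR R} (h : IsOmega Ω) (h' : IsOmega Ω') : Ω = Ω' := by
  have : (Ω : A2 n G →+ SR R) = (Ω' : A2 n G →+ SR R) :=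
    A2_hom_ext Ω.continuous_toFun Ω'.continuous_toFun
      (fun σ τ => Subtype.ext ((h.1 σ τ).trans (h'.1 σ τ).symm))
      fun σ => Subtype.ext ((h.2 σ).trans (h'.2 σ).symm)
  exact DFunLike.ext _ _ fun a => DFunLike.congr_fun this a

variable [CompactSpace G]

/-- Evaluating characters at a is a functional on the kernel of inflation. It extends to H² by
injectivity of ℤ/n, and the extension is represented by an element of `Sfr`. -/
theorem exists_pairing_eq_transgress (e : G1 n G ≃ₜ* Multiplicative (I → ZMod n)) (a : A2 n G) :
    ∃ s : Sfr n G, ∀ t, pairing n G s (boundedClass n G t) = transgress t a := by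
  obtain ⟨θ, hθ⟩ := exists_hom_zmod_extension H2_nsmul_eq_zero (boundedClass n G)
    (transgress.flip a) fun t ht => by
      rw [AddMonoidHom.flip_apply, transgress_eq_zero_of_class t ht, AddMonoidHom.zero_apply]
  obtain ⟨s, rfl⟩ := exists_pairing_eq e θ
  exact ⟨s, hθ⟩

/-- Conversely, pairing with s is a functional on characters of the compact group `A2`, hence
evaluation at a point. This gives surjectivity of Ω. -/
theorem exists_transgress_eq_pairing (s : Sfr n G) :
    ∃ a : A2 n G, ∀ t, transgress t a = pairing n G s (boundedClass n G t) :=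
  have := compactSpace_A2 (n := n) (G := G)
  exists_eval_eq (A := A2 n G) (T := BoundedCocycles n G) (transgress (n := n) (G := G))
    (fun t => continuous_transgress t) ((pairing n G s).comp (boundedClass n G))
    fun t ht => pairing_boundedClass_eq_zero s t ht

/-- The isomorphism `Ω_R`: a class `r` is evaluated through a cochain bounding its inflation. -/
theorem exists_isOmega [TotallyDisconnectedSpace G]
    (e : G1 n G ≃ₜ* Multiplicative (I → ZMod n))
    (hR : AddSubgroup.closure R = (inf2 n G).ker) : ∃ Ω : A2 n G ≃ₜ+ SR R, IsOmega Ω := by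
  have hcpt := compactSpace_A2 (n := n) (G := G)
  choose t ht using exists_boundedClass_eq hR
  have hmem : ∀ a : A2 n G, (fun r => transgress (t r) a) ∈ SR R := fun a => by
    obtain ⟨s, hs⟩ := exists_pairing_eq_transgress e a
    refine ⟨s, funext fun r => ?_⟩
    rw [← hs, ht]
    rfl
  let f : A2 n G →+ SR R := AddMonoidHom.mk' (fun a => ⟨fun r => transgress (t r) a, hmem a⟩)
    fun a b => Subtype.ext (funext fun r => map_add _ _ _)
  have hf : Continuous f :=
    Continuous.subtype_mk (continuous_pi fun r => continuous_transgress (t r)) _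
  have hinj : Function.Injective f := by
    rw [injective_iff_map_eq_zero]
    intro a ha
    by_contra hne
    obtain ⟨χ, hχ, hχa⟩ := exists_character_A2 hne
    obtain ⟨t₀, rfl⟩ := exists_transgress_eq χ hχ
    obtain ⟨s, hs⟩ := exists_pairing_eq_transgress e a
    -- The element s representing a annihilates R, hence the whole kernel of inflation. So every
    -- continuous character vanishes at a, contrary to the choice of χ.
    have h0 : AddSubgroup.closure R ≤ (pairing n G s).ker := by
      rw [AddSubgroup.closure_le]
      intro r hr
      have h1 : transgress (t ⟨r, hr⟩) a = 0 := congrFun (congrArg Subtype.val ha) ⟨r, hr⟩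
      rw [← hs, ht] at h1
      exact h1
    rw [hR, ← range_boundedClass] at h0
    exact hχa ((hs t₀).symm.trans (h0 ⟨t₀, rfl⟩))
  have hsurj : Function.Surjective f := by
    intro c
    obtain ⟨s, hs⟩ := exists_pairing_eq_of_mem_SR c.2
    obtain ⟨a, ha⟩ := exists_transgress_eq_pairing s
    refine ⟨a, Subtype.ext (funext fun r => ?_)⟩
    change transgress (t r) a = c.1 r
    exact (ha (t r)).trans ((congrArg (pairing n G s) (ht r)).trans (hs r).symm)
  let E : A2 n G ≃+ SR R := AddEquiv.ofBijective f ⟨hinj, hsurj⟩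
  refine ⟨{ E with
    continuous_toFun := hf
    continuous_invFun := Continuous.continuous_symm_of_equiv_compact_to_t2 (f := E.toEquiv) hf },
    fun σ τ => funext fun r => ?_, fun σ => funext fun r => ?_⟩
  · refine (transgress_bracket (t r) σ τ).trans ?_
    exact (congrArg (commForm σ.toMul τ.toMul) (ht r)).trans
      (DFunLike.congr_fun (pairing_sBracket e σ τ) r.1).symm
  · refine (transgress_powPi (t r) σ).trans ?_
    exact (congrArg (powForm (G1_pow n G) σ.toMul) (ht r)).trans
      (DFunLike.congr_fun (pairing_sPow e σ) r.1).symm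

theorem IsOmega.bracket_apply (e : G1 n G ≃ₜ* Multiplicative (I → ZMod n))
    {Ω : A2 n G ≃ₜ+ SR R} (h : IsOmega Ω) (σ τ : A1 n G) (r : R) :
    (Ω (bracket σ τ) : R → ZMod n) r = commForm σ.toMul τ.toMul r.1 :=
  (congrFun (h.1 σ τ) r).trans (DFunLike.congr_fun (pairing_sBracket e σ τ) r.1)

theorem IsOmega.powPi_apply (e : G1 n G ≃ₜ* Multiplicative (I → ZMod n))
    {Ω : A2 n G ≃ₜ+ SR R} (h : IsOmega Ω) (σ : A1 n G) (r : R) :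
    (Ω (powPi σ) : R → ZMod n) r = powForm (G1_pow n G) σ.toMul r.1 :=
  (congrFun (h.2 σ) r).trans (DFunLike.congr_fun (pairing_sPow e σ) r.1)

end Omega

/-! ### Naturality of Ω. -/

section Functoriality

variable {n : ℕ} {G : Type*} [Group G] [TopologicalSpace G] [IsTopologicalGroup G]
  {H : Type*} [Group H] [TopologicalSpace H] [IsTopologicalGroup H] {I J : Type*}

theorem commForm_H2map (φ : G →ₜ* H) (σ τ : A1 n G) (h : H2 n (G1 n H)) :
    commForm σ.toMul τ.toMul (H2map n (map1 n φ) h) =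
      commForm (map1Add n φ σ).toMul (map1Add n φ τ).toMul h := by
  induction h using QuotientAddGroup.induction_on with | H ξ => ?_
  rfl

theorem powForm_H2map (φ : G →ₜ* H) (σ : A1 n G) (h : H2 n (G1 n H)) :
    powForm (G1_pow n G) σ.toMul (H2map n (map1 n φ) h) =
      powForm (G1_pow n H) (map1Add n φ σ).toMul h := by
  induction h using QuotientAddGroup.induction_on with | H ξ => ?_
  change ∑ k ∈ Finset.range n, ξ.1 (map1 n φ (σ.toMul ^ k), map1 n φ σ.toMul) =
    ∑ k ∈ Finset.range n, ξ.1 (map1 n φ σ.toMul ^ k, map1 n φ σ.toMul)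
  simp only [map_pow]

variable [NeZero n] [CompactSpace H]

/-- The map `c ↦ c ∘ φ₁^*` between the images of the restriction maps. -/
theorem exists_SR_map (eH : G1 n H ≃ₜ* Multiplicative (J → ZMod n)) (φ : G →ₜ* H)
    {RG : Set (H2 n (G1 n G))} {RH : Set (H2 n (G1 n H))}
    (hR : ∀ r ∈ RH, H2map n (map1 n φ) r ∈ RG) :
    ∃ Φ : SR RG →ₜ+ SR RH, ∀ (c : SR RG) (r : RH),
      (Φ c : RH → ZMod n) r = (c : RG → ZMod n) ⟨H2map n (map1 n φ) r, hR r r.2⟩ := by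
  have hmem : ∀ c : SR RG, (fun r : RH =>
      (c : RG → ZMod n) ⟨H2map n (map1 n φ) r, hR r r.2⟩) ∈ SR RH := by
    intro c
    obtain ⟨s, hs⟩ := exists_pairing_eq_of_mem_SR c.2
    -- No map between the groups `Sfr` is needed: the functional s ∘ φ₁^* on H² of `G1 n H` is
    -- itself the pairing with some s'.
    obtain ⟨s', hs'⟩ := exists_pairing_eq eH ((pairing n G s).comp (H2map n (map1 n φ)))
    refine ⟨s', funext fun r => ?_⟩
    rw [hs]
    exact DFunLike.congr_fun hs' r.1
  have hcont : Continuous fun c : SR RG => (⟨_, hmem c⟩ : SR RH) := by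
    refine Continuous.subtype_mk (continuous_pi fun r => ?_) _
    have h1 := continuous_apply (A := fun _ : RG => ZMod n) ⟨H2map n (map1 n φ) r, hR r r.2⟩
    exact h1.comp (continuous_subtype_val : Continuous fun c : SR RG => c.1)
  exact ⟨{ toFun := fun c => ⟨_, hmem c⟩
           map_zero' := rfl
           map_add' := fun _ _ => rfl
           continuous_toFun := hcont }, fun _ _ => rfl⟩

variable [CompactSpace G]

/-- The isomorphisms `Ω` are natural. -/
theorem SR_map_omega (eG : G1 n G ≃ₜ* Multiplicative (I → ZMod n))
    (eH : G1 n H ≃ₜ* Multiplicative (J → ZMod n)) (φ : G →ₜ* H)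
    {RG : Set (H2 n (G1 n G))} {RH : Set (H2 n (G1 n H))}
    (hR : ∀ r ∈ RH, H2map n (map1 n φ) r ∈ RG) (Φ : SR RG →ₜ+ SR RH)
    (hΦ : ∀ (c : SR RG) (r : RH),
      (Φ c : RH → ZMod n) r = (c : RG → ZMod n) ⟨H2map n (map1 n φ) r, hR r r.2⟩)
    {ΩG : A2 n G ≃ₜ+ SR RG} {ΩH : A2 n H ≃ₜ+ SR RH} (hG : IsOmega ΩG) (hH : IsOmega ΩH)
    (δ : A2 n G) : Φ (ΩG δ) = ΩH (map2 n φ δ) := by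
  have : (Φ : SR RG →+ SR RH).comp (ΩG : A2 n G →+ SR RG) =
      (ΩH : A2 n H →+ SR RH).comp (map2 n φ) := by
    -- On generators both sides are commutator or power forms, and these commute with pullback.
    refine A2_hom_ext (Φ.continuous_toFun.comp ΩG.continuous_toFun)
      (ΩH.continuous_toFun.comp (continuous_map2 φ)) (fun σ τ => ?_) fun σ => ?_
    · refine Subtype.ext (funext fun r => ?_)
      change (Φ (ΩG (bracket σ τ)) : RH → ZMod n) r = (ΩH (map2 n φ (bracket σ τ)) : RH → ZMod n) r
      rw [hΦ, hG.bracket_apply eG, map2_bracket, hH.bracket_apply eH]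
      exact commForm_H2map φ σ τ r.1
    · refine Subtype.ext (funext fun r => ?_)
      change (Φ (ΩG (powPi σ)) : RH → ZMod n) r = (ΩH (map2 n φ (powPi σ)) : RH → ZMod n) r
      rw [hΦ, hG.powPi_apply eG, map2_powPi, hH.powPi_apply eH]
      exact powForm_H2map φ σ r.1
  exact DFunLike.congr_fun this δ

end Functoriality

end ProfiniteH2

end

theorem theorem2 (n : ℕ) [NeZero n] :
    (∀ (G : Type*) [Group G] [TopologicalSpace G] [IsTopologicalGroup G] [CompactSpace G]
      [TotallyDisconnectedSpace G] (I : Type*),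
      Nonempty (G1 n G ≃ₜ* Multiplicative (I → ZMod n)) →
      (IsPairing (pairing n G) ∧
        ∀ P : Sfr n G →+ H2 n (G1 n G) →+ ZMod n, IsPairing P → P = pairing n G) ∧
      ∀ R : Set (H2 n (G1 n G)), AddSubgroup.closure R = (inf2 n G).ker →
        ∃! Ω : A2 n G ≃ₜ+ SR R, IsOmega Ω) ∧
    (∀ (G : Type*) [Group G] [TopologicalSpace G] [IsTopologicalGroup G] [CompactSpace G]
      [TotallyDisconnectedSpace G] (I : Type*)
      (H : Type*) [Group H] [TopologicalSpace H] [IsTopologicalGroup H] [CompactSpace H]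
      [TotallyDisconnectedSpace H] (J : Type*),
      Nonempty (G1 n G ≃ₜ* Multiplicative (I → ZMod n)) →
      Nonempty (G1 n H ≃ₜ* Multiplicative (J → ZMod n)) →
      ∀ (φ : G →ₜ* H) (RG : Set (H2 n (G1 n G))) (RH : Set (H2 n (G1 n H))),
        AddSubgroup.closure RG = (inf2 n G).ker →
        AddSubgroup.closure RH = (inf2 n H).ker →
        ∀ hR : ∀ r ∈ RH, H2map n (map1 n φ) r ∈ RG,
        ∃ Φ : SR RG →ₜ+ SR RH,
          (∀ (c : SR RG) (r : RH),
            (Φ c : RH → ZMod n) r = (c : RG → ZMod n) ⟨H2map n (map1 n φ) r, hR r r.2⟩) ∧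
          ∀ (ΩG : A2 n G ≃ₜ+ SR RG) (ΩH : A2 n H ≃ₜ+ SR RH), IsOmega ΩG → IsOmega ΩH →
            (∀ δ : A2 n G, Φ (ΩG δ) = ΩH (map2 n φ δ)) ∧
            (∀ σ τ : A1 n G, Φ (ΩG (bracket σ τ)) =
              ΩH (bracket (map1Add n φ σ) (map1Add n φ τ))) ∧
            (∀ σ : A1 n G, Φ (ΩG (powPi σ)) =
              ΩH (powPi (map1Add n φ σ)))) := by
  refine ⟨?_, ?_⟩
  · rintro G _ _ _ _ _ I ⟨e⟩
    refine ⟨⟨isPairing_pairing e, fun P hP => hP.unique e (isPairing_pairing e)⟩, fun R hR => ?_⟩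
    obtain ⟨Ω, hΩ⟩ := exists_isOmega e hR
    exact ⟨Ω, hΩ, fun Ω' hΩ' => hΩ'.unique hΩ⟩
  · rintro G _ _ _ _ _ I H _ _ _ _ _ J ⟨eG⟩ ⟨eH⟩ φ RG RH _ _ hR
    obtain ⟨Φ, hΦ⟩ := exists_SR_map eH φ hR
    refine ⟨Φ, hΦ, fun ΩG ΩH hG hH => ?_⟩
    have h := SR_map_omega eG eH φ hR Φ hΦ hG hH
    exact ⟨h, fun σ τ => by rw [h, map2_bracket], fun σ => by rw [h, map2_powPi]⟩
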